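/- Let $k$ be an algebraically closed field, let $d\geqslant 1$ be an integer, and let $\mathscr{T}$ be a $k$-linear $\operatorname{Hom}$-finite $(d+2)$-angulated category (in the sense of Geiss–Keller–Oppermann) with split idempotents and with $d$-suspension functor $\Sigma^d$. Assume that $\mathscr{T}$ has a Serre functor $S$, that is, an autoequivalence with natural isomorphisms $D\mathscr{T}(X,Y)\cong\mathscr{T}(Y,SX)$, where $D=\operatorname{Hom}_k(-,k)$. Let $T\in\mathscr{T}$ have endomorphism algebra $\Gamma=\operatorname{End}_{\mathscr{T}}T$, let $\operatorname{mod}\Gamma$ be the category of finite dimensional right $\Gamma$-modules, and let $\mathscr{D}$ be the essential image of the functor $\mathscr{T}(T,-):\mathscr{T}\to\operatorname{mod}\Gamma$. Assume that $T$ is cluster tilting in the sense of Oppermann–Thomas: $\mathscr{T}(T,\Sigma^dT)=0$, and each $X\in\mathscr{T}$ occurs in a $(d+2)$-angle $$T_d\to T_{d-1}\to\cdots\to T_0\to X\to\Sigma^dT_d$$ with $T_i\in\operatorname{add}T$ for $0\leqslant i\leqslant d$. Then: (i) $\mathscr{D}$ is a $d$-cluster tilting subcategory of $\operatorname{mod}\Gamma$,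 that is, $\mathscr{D}$ is functorially finite in $\operatorname{mod}\Gamma$ and $$\mathscr{D}=\{M\in\operatorname{mod}\Gamma\mid\operatorname{Ext}^i_\Gamma(M,\mathscr{D})=0\text{ for }1\leqslant i\leqslant d-1\}=\{M\in\operatorname{mod}\Gamma\mid\operatorname{Ext}^i_\Gamma(\mathscr{D},M)=0\text{ for }1\leqslant i\leqslant d-1\}.$$ (ii) The functor $\mathscr{T}(T,-)$ induces an equivalence of categories $\mathscr{T}/[\operatorname{add}\Sigma^dT]\to\mathscr{D}$, where $[\operatorname{add}\Sigma^dT]$ is the ideal of the morphisms which factor through an object of $\operatorname{add}\Sigma^dT$. (iii) $\Gamma$ is a $d$-Gorenstein algebra, that is, each injective module in $\operatorname{mod}\Gamma$ has projective dimension $\leqslant d$, and each projective module in $\operatorname{mod}\Gamma$ has injective dimension $\leqslant d$. (iv) If the global dimension of $\Gamma$ is finite, then it is at most $d$. -/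

import Mathlib

open CategoryTheory CategoryTheory.Limits

universe u v w

noncomputable section

namespace HigherAngulated

open ZeroObject

attribute [local instance] hasBinaryBiproducts_of_finite_biproducts

/-! ## `n`-`Σ`-sequences, for `n = d + 2`

The objects of a sequence are numbered in descending order, as in
`X_{d+1} ⟶ X_d ⟶ ⋯ ⟶ X_1 ⟶ X_0 ⟶ Σ X_{d+1}`. -/

/-- A `(d+2)`-`Σ`-sequence `X_{d+1} ⟶ X_d ⟶ ⋯ ⟶ X_1 ⟶ X_0 ⟶ Σ X_{d+1}`. -/
structure SigmaSeq (C : Type u) [Category.{v} C] (S : C ⥤ C) (d : ℕ) where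
  /-- the objects `X_0, …, X_{d+1}` -/
  obj : Fin (d + 2) → C
  /-- the morphisms `X_{i+1} ⟶ X_i` -/
  hom : ∀ i : Fin (d + 1), obj i.succ ⟶ obj i.castSucc
  /-- the connecting morphism `X_0 ⟶ Σ X_{d+1}` -/
  conn : obj 0 ⟶ S.obj (obj (Fin.last d).succ)

namespace SigmaSeq

section Morphisms

variable {C : Type u} [Category.{v} C] {S : C ⥤ C} {d : ℕ}

/-- A morphism of `(d+2)`-`Σ`-sequences. -/
structure Hom (X Y : SigmaSeq C S d) where
  /-- the components -/
  app : ∀ i : Fin (d + 2), X.obj i ⟶ Y.obj i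
  comm : ∀ i : Fin (d + 1), X.hom i ≫ app i.castSucc = app i.succ ≫ Y.hom i
  comm_conn : X.conn ≫ S.map (app (Fin.last d).succ) = app 0 ≫ Y.conn

/-- Two sequences are isomorphic if some morphism between them has invertible components. -/
def Isomorphic (X Y : SigmaSeq C S d) : Prop :=
  ∃ φ : Hom X Y, ∀ i, IsIso (φ.app i)

end Morphisms

variable {C : Type u} [Category.{v} C] [Preadditive C] [HasFiniteBiproducts C]
  {S : C ⥤ C} {d : ℕ}

/-- The termwise direct sum of two sequences. -/
def sum (X Y : SigmaSeq C S d) : SigmaSeq C S d where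
  obj i := X.obj i ⊞ Y.obj i
  hom i := biprod.map (X.hom i) (Y.hom i)
  conn := biprod.desc (X.conn ≫ S.map biprod.inl) (Y.conn ≫ S.map biprod.inr)

/-- The trivial sequence `X ⟶ X ⟶ 0 ⟶ ⋯ ⟶ 0 ⟶ Σ X` whose first morphism is the identity. -/
def trivial (S : C ⥤ C) (d : ℕ) (X : C) : SigmaSeq C S d where
  obj i := if d ≤ (i : ℕ) then X else 0
  hom i :=
    if h : (i : ℕ) = d then
      eqToHom (by
        rw [if_pos (show d ≤ (i.succ : ℕ) by simp [h]),
          if_pos (show d ≤ (i.castSucc : ℕ) by simp [h])])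
    else 0
  conn := 0

/-- The left rotation `X_d ⟶ ⋯ ⟶ X_0 ⟶ Σ X_{d+1} ⟶ Σ X_d` of a sequence, whose last morphism is
`(-1)^(d+2)` times the suspension of the first morphism `X_{d+1} ⟶ X_d`. -/
def rotate (X : SigmaSeq C S d) : SigmaSeq C S d where
  obj := Fin.cons (S.obj (X.obj (Fin.last d).succ)) (fun i : Fin (d + 1) => X.obj i.castSucc)
  hom := Fin.cases X.conn (fun i : Fin d => X.hom i.castSucc)
  conn := ((-1 : ℤ) ^ (d + 2)) • S.map (X.hom (Fin.last d))

/-- The mapping cone of a morphism `φ : X ⟶ Y` of sequences, which reads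
`X_d ⊞ Y_{d+1} ⟶ X_{d-1} ⊞ Y_d ⟶ ⋯ ⟶ Σ X_{d+1} ⊞ Y_0 ⟶ Σ (X_d ⊞ Y_{d+1})`.
On the first summand its morphisms are `(-α, φ)`, on the second they are `(0, β)`, where `α` and `β`
are the morphisms of `X` and `Y`; the connecting morphism has `(-Σ α, Σ φ)` and `(0, β)`. -/
def cone {X Y : SigmaSeq C S d} (φ : Hom X Y) : SigmaSeq C S d where
  obj i := X.rotate.obj i ⊞ Y.obj i
  hom i := biprod.desc
    (biprod.lift (-(X.rotate.hom i))
      (show X.rotate.obj i.succ ⟶ Y.obj i.castSucc from φ.app i.castSucc))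
    (Y.hom i ≫ biprod.inr)
  conn := biprod.desc
    (S.map (show X.obj (Fin.last d).succ ⟶
        X.rotate.obj (Fin.last d).succ ⊞ Y.obj (Fin.last d).succ from
      biprod.lift (-(X.hom (Fin.last d))) (φ.app (Fin.last d).succ)))
    (Y.conn ≫ S.map biprod.inr)

end SigmaSeq

/-- A `(d+2)`-angulation (Geiss–Keller–Oppermann) of the additive category `C` with
`d`-suspension functor `S`: a class of `(d+2)`-`Σ`-sequences, called `(d+2)`-angles, subject to the
axioms (F1)–(F4). -/
structure Angulation (C : Type u) [Category.{v} C] [Preadditive C] [HasFiniteBiproducts C]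
    (S : C ⥤ C) (d : ℕ) where
  /-- the class of `(d+2)`-angles -/
  angles : Set (SigmaSeq C S d)
  /-- (F1)(a): angles are closed under isomorphisms, … -/
  iso_mem : ∀ X Y : SigmaSeq C S d, X.Isomorphic Y → X ∈ angles → Y ∈ angles
  /-- … under direct sums, … -/
  sum_mem : ∀ X Y : SigmaSeq C S d, X ∈ angles → Y ∈ angles → X.sum Y ∈ angles
  /-- … and under direct summands. -/
  mem_of_sum_mem : ∀ X Y : SigmaSeq C S d, X.sum Y ∈ angles → X ∈ angles
  /-- (F1)(b) -/
  trivial_mem : ∀ X : C, SigmaSeq.trivial S d X ∈ angles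
  /-- (F1)(c): each morphism is the first morphism of an angle. -/
  exists_angle : ∀ ⦃X Y : C⦄ (f : X ⟶ Y), ∃ A ∈ angles,
    ∃ (e : A.obj (Fin.last d).succ ≅ X) (e' : A.obj (Fin.last d).castSucc ≅ Y),
      A.hom (Fin.last d) ≫ e'.hom = e.hom ≫ f
  /-- (F2) -/
  rotate_mem_iff : ∀ X : SigmaSeq C S d, X ∈ angles ↔ X.rotate ∈ angles
  /-- (F3): a commutative square on the first morphisms of two angles extends to a morphism. -/
  exists_hom : ∀ A ∈ angles, ∀ B ∈ angles,
    ∀ (f : A.obj (Fin.last d).succ ⟶ B.obj (Fin.last d).succ)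
      (g : A.obj (Fin.last d).castSucc ⟶ B.obj (Fin.last d).castSucc),
      A.hom (Fin.last d) ≫ g = f ≫ B.hom (Fin.last d) →
      ∃ φ : SigmaSeq.Hom A B,
        φ.app (Fin.last d).succ = f ∧ φ.app (Fin.last d).castSucc = g
  /-- (F4): the extension can be chosen such that its mapping cone is an angle. -/
  exists_hom_cone_mem : ∀ A ∈ angles, ∀ B ∈ angles,
    ∀ (f : A.obj (Fin.last d).succ ⟶ B.obj (Fin.last d).succ)
      (g : A.obj (Fin.last d).castSucc ⟶ B.obj (Fin.last d).castSucc),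
      A.hom (Fin.last d) ≫ g = f ≫ B.hom (Fin.last d) →
      ∃ φ : SigmaSeq.Hom A B,
        φ.app (Fin.last d).succ = f ∧ φ.app (Fin.last d).castSucc = g ∧
          SigmaSeq.cone φ ∈ angles

/-- A Serre functor on a `k`-linear category: an autoequivalence `S` with isomorphisms
`D Hom(X, Y) ≅ Hom(Y, S X)`, natural in `X` and `Y`, where `D = Hom_k(-, k)`. -/
structure SerreFunctor (k : Type w) [Field k] (C : Type u) [Category.{v} C] [Preadditive C]
    [Linear k C] where
  /-- the functor `S` -/
  functor : C ⥤ C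
  isEquivalence : functor.IsEquivalence
  /-- the isomorphism `D Hom(X, Y) ≅ Hom(Y, S X)` -/
  iso : ∀ X Y : C, Module.Dual k (X ⟶ Y) ≃ₗ[k] (Y ⟶ functor.obj X)
  naturality_right : ∀ (X : C) ⦃Y Y' : C⦄ (g : Y ⟶ Y') (φ : Module.Dual k (X ⟶ Y')),
    iso X Y (φ ∘ₗ Linear.rightComp k X g) = g ≫ iso X Y' φ
  naturality_left : ∀ ⦃X X' : C⦄ (Y : C) (f : X ⟶ X') (φ : Module.Dual k (X ⟶ Y)),
    iso X' Y (φ ∘ₗ Linear.leftComp k Y f) = iso X Y φ ≫ functor.map f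

section AddClosure

variable {C : Type u} [Category.{v} C] [Preadditive C] [HasFiniteBiproducts C]

/-- `add T`: the direct summands of finite direct sums of copies of `T`. Direct summands are
expressed as retracts, which is the same thing in a category with split idempotents. -/
def add (T : C) : ObjectProperty C :=
  fun X => ∃ n : ℕ, Nonempty (Retract X (⨁ fun _ : Fin n => T))

/-- `T` is cluster tilting in the sense of Oppermann–Thomas: `Hom(T, Σ T) = 0`, and each object `X`
is in an angle `T_d ⟶ ⋯ ⟶ T_0 ⟶ X ⟶ Σ T_d` with all `T_i` in `add T`. -/
structure Angulation.IsClusterTilting {S : C ⥤ C} {d : ℕ} (𝒜 : Angulation C S d) (T : C) :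
    Prop where
  hom_eq_zero : ∀ f : T ⟶ S.obj T, f = 0
  exists_angle : ∀ X : C, ∃ A ∈ 𝒜.angles,
    Nonempty (A.obj 0 ≅ X) ∧ ∀ i : Fin (d + 1), add T (A.obj i.succ)

end AddClosure

section Quotients

variable {C : Type u} [Category.{v} C] [Preadditive C]

/-- The congruence `f ∼ g` iff `f - g` lies in the ideal `[P]` of the morphisms which factor through
an object satisfying `P`. The quotient category by it is `C / [P]`. -/
def idealRel (P : ObjectProperty C) : HomRel C :=
  fun X Y f g => ∃ (Z : C) (_ : P Z) (a : X ⟶ Z) (b : Z ⟶ Y), f - g = a ≫ b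

/-- `F : C ⥤ D` is well defined on `C / [P]`, and the induced functor `C / [P] ⥤ D` is an
equivalence of categories. -/
def InducesEquivalence {D : Type*} [Category* D] (F : C ⥤ D) (P : ObjectProperty C) : Prop :=
  ∃ H : ∀ (X Y : C) (f g : X ⟶ Y), idealRel P f g → F.map f = F.map g,
    (CategoryTheory.Quotient.lift (idealRel P) F H).IsEquivalence

end Quotients

section Modules

variable (k : Type w) [Field k] (A : Type v) [Ring A] [Algebra k A]

/-- The `A`-modules which are finite dimensional over `k`. -/
def finDimModules : ObjectProperty (ModuleCat.{v} A) :=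
  fun M => FiniteDimensional k ((ModuleCat.restrictScalars (algebraMap k A)).obj M)

variable {A}

/-- `𝒳` is functorially finite in the category of finite dimensional modules: each finite
dimensional module has a left and a right `𝒳`-approximation. -/
structure IsFunctoriallyFinite (𝒳 : ObjectProperty (ModuleCat.{v} A)) : Prop where
  exists_left_approximation : ∀ M, finDimModules k A M →
    ∃ (X : ModuleCat.{v} A) (_ : 𝒳 X) (f : M ⟶ X),
      ∀ (X' : ModuleCat.{v} A) (_ : 𝒳 X') (g : M ⟶ X'), ∃ h : X ⟶ X', f ≫ h = g
  exists_right_approximation : ∀ M, finDimModules k A M →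
    ∃ (X : ModuleCat.{v} A) (_ : 𝒳 X) (f : X ⟶ M),
      ∀ (X' : ModuleCat.{v} A) (_ : 𝒳 X') (g : X' ⟶ M), ∃ h : X' ⟶ X, h ≫ f = g

/-- `𝒳` is weakly `d`-cluster tilting in the category of finite dimensional modules. -/
structure IsWeaklyClusterTilting (d : ℕ) (𝒳 : ObjectProperty (ModuleCat.{v} A)) : Prop where
  prop_iff_left : ∀ M, 𝒳 M ↔ finDimModules k A M ∧
    ∀ X, 𝒳 X → ∀ i : ℕ, 1 ≤ i → i < d → Subsingleton (Abelian.Ext.{v} M X i)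
  prop_iff_right : ∀ M, 𝒳 M ↔ finDimModules k A M ∧
    ∀ X, 𝒳 X → ∀ i : ℕ, 1 ≤ i → i < d → Subsingleton (Abelian.Ext.{v} X M i)

/-- `𝒳` is `d`-cluster tilting in the category of finite dimensional modules. -/
structure IsClusterTiltingSubcategory (d : ℕ) (𝒳 : ObjectProperty (ModuleCat.{v} A)) : Prop where
  isWeaklyClusterTilting : IsWeaklyClusterTilting k d 𝒳
  isFunctoriallyFinite : IsFunctoriallyFinite k 𝒳

variable (A)

/-- `d`-Gorenstein: among the finite dimensional modules, the injective ones have projective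
dimension at most `d` and the projective ones have injective dimension at most `d`. -/
structure IsGorenstein (d : ℕ) : Prop where
  projective_dimension_le : ∀ M : ModuleCat.{v} A, finDimModules k A M → Injective M →
    HasProjectiveDimensionLE M d
  injective_dimension_le : ∀ M : ModuleCat.{v} A, finDimModules k A M → Projective M →
    HasInjectiveDimensionLE M d

/-- The global dimension of `A`: the supremum of the projective dimensions of all modules. -/
def globalDimension : WithBot ℕ∞ := ⨆ M : ModuleCat.{v} A, projectiveDimension M

end Modules

section Image

variable {C : Type u} [Category.{v} C] [Preadditive C]

/-- The opposite of the endomorphism algebra `Γ = End T`: right `Γ`-modules are modules over it. -/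
abbrev EndOp (T : C) : Type v := (End T)ᵐᵒᵖ

/-- The functor `Hom(T, -)` to right `Γ`-modules, where `Γ = End T` acts by precomposition. -/
abbrev homFunctor (T : C) : C ⥤ ModuleCat.{v} (EndOp T) := preadditiveCoyonedaObj T

end Image

end HigherAngulated

end

/-! Write Σ for `S`, R for the Serre functor and G = Hom(T, -). Angles are sequences of weak kernels
(`homExact_m`), so G makes them exact. Serre duality turns each weak kernel into a weak cokernel
(`SerreFunctor.exists_desc`). G sends `add T` to projectives and `add (R T)` to injectives, and
finite modules are quotients of the former and submodules of the latter.

Equivalence: take an angle T_d ⟶ ⋯ ⟶ T_0 ⟶ X ⟶ ΣT_d. Maps out of G(T_i) come from C, and descending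
along weak cokernels makes G full. A map killed by G vanishes on T_0, hence factors through ΣT_d.

Cluster tilting: the same angle begins a projective resolution of G(X). Homming it into G(Y) stays
exact in the relevant degrees because weak kernels are weak cokernels, so Ext vanishes in degrees 1,
…, d - 1. Conversely, present a finite module M as the kernel of a map between injectives, or the
cokernel of one between projectives, lift that map to C and complete it to an angle. This yields a
right or left approximation and a resolution or coresolution of M of length d - 1 by the essential
image. If the Ext groups vanish, dimension shifting makes M a retract of its first term. The
essential image is closed under retracts because idempotents lift along the full functor G
(`essImage_of_retract`).

Gorenstein: Hom(ΣT, RT) is dual to Hom(T, ΣT) = 0, so for X in `add (R T)` the resolving angle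
becomes a projective resolution of length d. Applying Hom(T, R -) to a resolving angle gives the
injective statement.

Global dimension: since projectives have injective dimension at most d, a finite module of finite
projective dimension has it at most d; Baer's criterion passes to all modules. -/

noncomputable section

namespace HigherAngulated

open ZeroObject

/-! ### Weak kernels. -/

section HomExact

variable {C : Type u} [Category.{v} C] [Preadditive C]

/-- `X ⟶ Y ⟶ Z` is exact under all functors `Hom(W, -)`, that is, `f` is a weak kernel of `g`. -/
structure HomExact {X Y Z : C} (f : X ⟶ Y) (g : Y ⟶ Z) : Prop where
  zero : f ≫ g = 0
  exists_lift : ∀ ⦃W : C⦄ (h : W ⟶ Y), h ≫ g = 0 → ∃ l : W ⟶ X, l ≫ f = h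

theorem HomExact.map {D : Type*} [Category D] [Preadditive D] (F : C ⥤ D) [F.IsEquivalence]
    {X Y Z : C} {f : X ⟶ Y} {g : Y ⟶ Z} (h : HomExact f g) : HomExact (F.map f) (F.map g) where
  zero := by rw [← F.map_comp, h.zero, F.map_zero]
  exists_lift W a ha := by
    obtain ⟨b, hb⟩ := F.map_surjective ((F.objObjPreimageIso W).hom ≫ a)
    obtain ⟨l, hl⟩ := h.exists_lift b (F.map_injective (by simp [hb, ha]))
    exact ⟨(F.objObjPreimageIso W).inv ≫ F.map l, by simp [← F.map_comp, hl, hb]⟩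

theorem HomExact.of_map {D : Type*} [Category D] [Preadditive D] (F : C ⥤ D) [F.IsEquivalence]
    {X Y Z : C} {f : X ⟶ Y} {g : Y ⟶ Z} (h : HomExact (F.map f) (F.map g)) : HomExact f g where
  zero := F.map_injective (by rw [F.map_comp, h.zero, F.map_zero])
  exists_lift W a ha := by
    obtain ⟨l, hl⟩ := h.exists_lift (F.map a) (by rw [← F.map_comp, ha, F.map_zero])
    obtain ⟨l, rfl⟩ := F.map_surjective l
    exact ⟨l, F.map_injective (by rw [F.map_comp, hl])⟩

theorem HomExact.of_iso {X Y Z X' Y' Z' : C} {f : X ⟶ Y} {g : Y ⟶ Z} (h : HomExact f g)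
    (eX : X ≅ X') (eY : Y ≅ Y') (eZ : Z ≅ Z') {f' : X' ⟶ Y'} {g' : Y' ⟶ Z'}
    (hf : f ≫ eY.hom = eX.hom ≫ f') (hg : g ≫ eZ.hom = eY.hom ≫ g') : HomExact f' g' where
  zero := by
    rw [← cancel_epi eX.hom, ← Category.assoc, ← hf, Category.assoc, ← hg, reassoc_of% h.zero]
    simp
  exists_lift W a ha := by
    obtain ⟨l, hl⟩ := h.exists_lift (a ≫ eY.inv) (by
      rw [← cancel_mono eZ.hom, Category.assoc, Category.assoc, hg]; simp [ha])
    refine ⟨l ≫ eX.hom, ?_⟩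
    rw [Category.assoc, ← hf, reassoc_of% hl]; simp

/-- Removes the sign that rotation puts on the connecting morphism. -/
theorem homExact_neg_right {X Y Z : C} {f : X ⟶ Y} {g : Y ⟶ Z} (n : ℕ)
    (h : HomExact f (((-1 : ℤ) ^ n) • g)) : HomExact f g := by
  rcases neg_one_pow_eq_or ℤ n with hn | hn
  · simpa [hn] using h
  · rw [hn] at h
    exact ⟨by simpa using h.zero, fun W a ha => h.exists_lift a (by simpa using ha)⟩

end HomExact

namespace SigmaSeq

variable {C : Type u} [Category.{v} C] {S : C ⥤ C} {d : ℕ}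

/-- The `j`-th object of a sequence. -/
abbrev o (A : SigmaSeq C S d) (j : ℕ) (h : j < d + 2) : C := A.obj ⟨j, h⟩

/-- The morphism from the `(j + 1)`-st to the `j`-th object of a sequence. -/
abbrev m (A : SigmaSeq C S d) (j : ℕ) (h : j < d + 1) :
    A.o (j + 1) (Nat.succ_lt_succ h) ⟶ A.o j (Nat.lt_succ_of_lt h) :=
  A.hom ⟨j, h⟩

/-- The connecting morphism of a sequence. -/
abbrev c (A : SigmaSeq C S d) :
    A.o 0 (Nat.succ_pos _) ⟶ S.obj (A.o (d + 1) (Nat.lt_succ_self _)) :=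
  A.conn

end SigmaSeq

/-! ### Exactness of angles. -/

namespace Angulation

variable {C : Type u} [Category.{v} C] [Preadditive C] [HasFiniteBiproducts C]

theorem exists_trivial_iso (S : C ⥤ C) (d : ℕ) (W : C) :
    ∃ (e₁ : (SigmaSeq.trivial S d W).obj (Fin.last d).succ ≅ W)
      (e₂ : (SigmaSeq.trivial S d W).obj (Fin.last d).castSucc ≅ W),
      (SigmaSeq.trivial S d W).hom (Fin.last d) = e₁.hom ≫ e₂.inv := by
  refine ⟨eqToIso (if_pos (by simp)), eqToIso (if_pos (by simp)), ?_⟩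
  simp [SigmaSeq.trivial]

theorem isZero_trivial_obj (S : C ⥤ C) (d : ℕ) (W : C) (i : Fin (d + 2)) (hi : (i : ℕ) < d) :
    IsZero ((SigmaSeq.trivial S d W).obj i) := by
  have : (SigmaSeq.trivial S d W).obj i = 0 := if_neg (by lia)
  rw [this]
  exact isZero_zero C

/-- (F3) maps the trivial angle on the first object to `A`, with `A.hom` as second component. The
third object of the trivial angle is zero because d = e + 1 is positive. -/
theorem first_comp_eq_zero {e : ℕ} {S : C ⥤ C} (𝒜 : Angulation C S (e + 1))
    {A : SigmaSeq C S (e + 1)} (hA : A ∈ 𝒜.angles) :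
    A.m (e + 1) (by lia) ≫ A.m e (by lia) = 0 := by
  obtain ⟨e₁, e₂, he⟩ := exists_trivial_iso S (e + 1) (A.o (e + 2) (by lia))
  obtain ⟨φ, h1, h2⟩ := 𝒜.exists_hom _ (𝒜.trivial_mem _) A hA e₁.hom
    (e₂.hom ≫ A.hom (Fin.last _)) (by rw [he]; simp)
  have hc := φ.comm ⟨e, by lia⟩
  rw [(isZero_trivial_obj S (e + 1) _ (Fin.castSucc ⟨e, by lia⟩) (by simp)).eq_of_tgt
    ((SigmaSeq.trivial S (e + 1) _).hom ⟨e, by lia⟩) 0, zero_comp] at hc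
  change _ = φ.app (Fin.last (e + 1)).castSucc ≫ A.hom ⟨e, by lia⟩ at hc
  rw [h2, Category.assoc] at hc
  rw [← cancel_epi e₂.hom]
  exact hc.symm.trans comp_zero.symm

/-- A morphism `h` with zero composite defines, by (F3), a morphism from the rotated trivial angle
on `W` to the rotation of `A`. Its last component is the suspension of the lift; the two rotation
signs cancel. -/
theorem homExact_first {e : ℕ} {S : C ⥤ C} [S.IsEquivalence] (𝒜 : Angulation C S (e + 1))
    {A : SigmaSeq C S (e + 1)} (hA : A ∈ 𝒜.angles) :
    HomExact (A.m (e + 1) (by lia)) (A.m e (by lia)) := by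
  refine ⟨𝒜.first_comp_eq_zero hA, fun W h hh => ?_⟩
  obtain ⟨e₁, e₂, he⟩ := exists_trivial_iso S (e + 1) W
  have hz : IsZero ((SigmaSeq.trivial S (e + 1) W).rotate.obj (Fin.last (e + 1)).castSucc) :=
    isZero_trivial_obj S (e + 1) W ⟨e, by lia⟩ (by simp)
  obtain ⟨φ, h1, -⟩ := 𝒜.exists_hom _ ((𝒜.rotate_mem_iff _).1 (𝒜.trivial_mem W)) _
    ((𝒜.rotate_mem_iff _).1 hA)
    (show (SigmaSeq.trivial S (e + 1) W).obj (Fin.last (e + 1)).castSucc ⟶ _ from e₂.hom ≫ h) 0 (by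
    rw [comp_zero]
    change 0 = (e₂.hom ≫ h) ≫ A.m e (by lia)
    rw [Category.assoc, hh, comp_zero])
  have hc := φ.comm_conn
  rw [h1] at hc
  obtain ⟨g, hg⟩ := S.map_surjective (show S.obj ((SigmaSeq.trivial S (e + 1) W).obj
    (Fin.last (e + 1)).succ) ⟶ S.obj (A.obj (Fin.last (e + 1)).succ) from φ.app 0)
  change (((-1 : ℤ) ^ (e + 1 + 2)) • S.map ((SigmaSeq.trivial S (e + 1) W).hom
      (Fin.last (e + 1)))) ≫ S.map (e₂.hom ≫ h) =
    (show S.obj ((SigmaSeq.trivial S (e + 1) W).obj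
      (Fin.last (e + 1)).succ) ⟶ S.obj (A.obj (Fin.last (e + 1)).succ) from φ.app 0) ≫
      (((-1 : ℤ) ^ (e + 1 + 2)) • S.map (A.hom (Fin.last (e + 1)))) at hc
  rw [← hg, Preadditive.zsmul_comp, Preadditive.comp_zsmul, ← S.map_comp, ← S.map_comp, he] at hc
  have hc' : (e₁.hom ≫ e₂.inv) ≫ e₂.hom ≫ h = g ≫ A.hom (Fin.last (e + 1)) := by
    apply S.map_injective
    rcases neg_one_pow_eq_or ℤ (e + 1 + 2) with hn | hn <;> simpa [hn] using hc
  refine ⟨e₁.inv ≫ g, ?_⟩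
  rw [Category.assoc]
  change e₁.inv ≫ g ≫ A.hom (Fin.last (e + 1)) = h
  rw [← hc']
  simp

theorem homExact_m {d : ℕ} {S : C ⥤ C} [S.IsEquivalence] (𝒜 : Angulation C S d)
    {A : SigmaSeq C S d} (hA : A ∈ 𝒜.angles) (j : ℕ)
    (hj : j + 1 < d + 1) : HomExact (A.m (j + 1) hj) (A.m j (by lia)) := by
  obtain ⟨e, rfl⟩ : ∃ e, d = e + 1 := ⟨d - 1, by lia⟩
  obtain ⟨i, hi⟩ : ∃ i, j + i = e := ⟨e - j, by lia⟩
  induction i generalizing j A with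
  | zero =>
    obtain rfl : j = e := by lia
    exact 𝒜.homExact_first hA
  -- Rotation raises positions by one, so `i` counts the rotations needed to move the pair to the
  -- beginning of the angle.
  | succ i ih => exact ih (j := j + 1) ((𝒜.rotate_mem_iff _).1 hA) (by lia) (by lia)

theorem homExact_conn {d : ℕ} {S : C ⥤ C} [S.IsEquivalence] (𝒜 : Angulation C S d)
    (hd : 1 ≤ d) {A : SigmaSeq C S d} (hA : A ∈ 𝒜.angles) :
    HomExact (A.m 0 (by lia)) A.c := by
  have h := 𝒜.homExact_m ((𝒜.rotate_mem_iff _).1 hA) 0 (by lia)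
  exact h

theorem homExact_map {d : ℕ} {S : C ⥤ C} [S.IsEquivalence] (𝒜 : Angulation C S d)
    (hd : 1 ≤ d) {A : SigmaSeq C S d} (hA : A ∈ 𝒜.angles) :
    HomExact A.c (S.map (A.m d (by lia))) :=
  homExact_neg_right (d + 2) (𝒜.homExact_conn hd ((𝒜.rotate_mem_iff _).1 hA))

/-- Each morphism is the morphism `A_1 ⟶ A_0` of an angle, up to isomorphism. -/
theorem exists_angle_m_zero {d : ℕ} {S : C ⥤ C} [S.IsEquivalence] (𝒜 : Angulation C S d)
    {X Y : C} (f : X ⟶ Y) :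
    ∃ A ∈ 𝒜.angles, ∃ (e₁ : A.o 1 (by lia) ≅ X) (e₀ : A.o 0 (by lia) ≅ Y),
      A.m 0 (by lia) ≫ e₀.hom = e₁.hom ≫ f := by
  obtain ⟨f', hf'⟩ := S.map_surjective
    ((S.objObjPreimageIso X).hom ≫ f ≫ (S.objObjPreimageIso Y).inv)
  obtain ⟨A, hA, e, e', he⟩ := 𝒜.exists_angle f'
  -- Two rotations turn the first morphism of `A` into the one from position 1 to position 0, up to
  -- suspension and sign; `c` absorbs the sign.
  obtain ⟨c, hc⟩ : ∃ c : S.obj (S.objPreimage Y) ≅ S.obj (S.objPreimage Y),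
      c.hom = ((-1 : ℤ) ^ (d + 2)) • 𝟙 _ := by
    rcases neg_one_pow_eq_or ℤ (d + 2) with hn | hn
    · exact ⟨Iso.refl _, by simp [hn]⟩
    · exact ⟨⟨-𝟙 _, -𝟙 _, by simp, by simp⟩, by simp [hn]⟩
  refine ⟨A.rotate.rotate, (𝒜.rotate_mem_iff _).1 ((𝒜.rotate_mem_iff _).1 hA),
    S.mapIso e ≪≫ S.objObjPreimageIso X, S.mapIso e' ≪≫ c ≪≫ S.objObjPreimageIso Y, ?_⟩
  change (((-1 : ℤ) ^ (d + 2)) • S.map (A.hom (Fin.last d))) ≫ S.map e'.hom ≫ c.hom ≫ _ =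
    (S.map e.hom ≫ _) ≫ f
  have h2 : S.map (A.hom (Fin.last d)) ≫ S.map e'.hom = S.map e.hom ≫ S.map f' := by
    rw [← S.map_comp, ← S.map_comp, he]
  have hs : ((-1 : ℤ) ^ (d + 2)) * ((-1 : ℤ) ^ (d + 2)) = 1 := by
    rw [← mul_pow]; simp
  rw [hc, Preadditive.zsmul_comp, Preadditive.zsmul_comp, Preadditive.comp_zsmul,
    Preadditive.comp_zsmul, smul_smul, hs, one_smul, reassoc_of% h2, hf']
  simp

/-- Each morphism is the first morphism of an angle, up to isomorphism. -/
theorem exists_angle_m_last {d : ℕ} {S : C ⥤ C} (𝒜 : Angulation C S d) {X Y : C} (f : X ⟶ Y) :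
    ∃ A ∈ 𝒜.angles, ∃ (e : A.o (d + 1) (by lia) ≅ X) (e' : A.o d (by lia) ≅ Y),
      A.m d (by lia) ≫ e'.hom = e.hom ≫ f :=
  𝒜.exists_angle f

theorem IsClusterTilting.exists_resolving_angle {d : ℕ} {S : C ⥤ C} {𝒜 : Angulation C S d} {T : C}
    (hT : 𝒜.IsClusterTilting T) (X : C) : ∃ A ∈ 𝒜.angles, ∃ _ : A.o 0 (by lia) ≅ X,
      ∀ (i : ℕ) (hi : i < d + 1), add T (A.o (i + 1) (by lia)) := by
  obtain ⟨A, hA, ⟨e⟩, h⟩ := hT.exists_angle X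
  exact ⟨A, hA, e, fun i hi => h ⟨i, hi⟩⟩

end Angulation

/-! ### Serre duality. -/

section Serre

variable {k : Type w} [Field k] {C : Type u} [Category.{v} C] [Preadditive C] [Linear k C]

namespace SerreFunctor

instance (R : SerreFunctor k C) : R.functor.IsEquivalence := R.isEquivalence

/-- Write W ≅ R V. Exactness of Hom(V, -) on the weak kernel dualizes over the field to exactness of
Hom(-, R V): a form that vanishes on the kernel of composition with `g` factors through that
composition. -/
theorem exists_desc (R : SerreFunctor k C) {X Y Z : C} {f : X ⟶ Y} {g : Y ⟶ Z}
    (h : HomExact f g) {W : C} (a : Y ⟶ W) (ha : f ≫ a = 0) : ∃ b : Z ⟶ W, g ≫ b = a := by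
  let V := R.functor.objPreimage W
  let e : R.functor.obj V ≅ W := R.functor.objObjPreimageIso W
  obtain ⟨φ, hφ⟩ := (R.iso V Y).surjective (a ≫ e.inv)
  have h0 : φ ∘ₗ Linear.rightComp k V f = 0 := by
    apply (R.iso V X).injective
    rw [R.naturality_right, hφ, reassoc_of% ha, zero_comp, map_zero]
  obtain ⟨ψ, hψ⟩ : φ ∈ LinearMap.range (Linear.rightComp k V g).dualMap := by
    rw [LinearMap.range_dualMap_eq_dualAnnihilator_ker, Submodule.mem_dualAnnihilator]
    intro x hx
    obtain ⟨l, rfl⟩ := h.exists_lift x (by simpa using hx)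
    exact LinearMap.congr_fun h0 l
  rw [LinearMap.dualMap_apply'] at hψ
  refine ⟨R.iso V Z ψ ≫ e.hom, ?_⟩
  rw [← Category.assoc, ← R.naturality_right, hψ, hφ]
  simp

/-- `Hom(X, Y) = 0` if and only if `Hom(Y, R X) = 0`. -/
theorem eq_zero_iff (R : SerreFunctor k C) (X Y : C) :
    (∀ f : X ⟶ Y, f = 0) ↔ ∀ f : Y ⟶ R.functor.obj X, f = 0 := by
  constructor
  · intro h f
    obtain ⟨φ, rfl⟩ := (R.iso X Y).surjective f
    have : φ = 0 := by ext x; simp [h x]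
    rw [this, map_zero]
  · intro h f
    rw [← Module.forall_dual_apply_eq_zero_iff k]
    intro φ
    rw [(R.iso X Y).injective ((h (R.iso X Y φ)).trans (map_zero _).symm)]
    rfl

end SerreFunctor

end Serre

/-! ### Resolutions and dimension shifting. -/

section Ext

open Abelian (Ext)

variable {C : Type u} [Category.{v} C] [Abelian C]

theorem exact_factorThruImage {X Y Z : C} (f : X ⟶ Y) (g : Y ⟶ Z) (w : f ≫ g = 0)
    (h : (ShortComplex.mk f g w).Exact) : ∃ w', (ShortComplex.mk f (factorThruImage g) w').Exact := by
  have w₁ : f ≫ factorThruImage g = 0 := by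
    rw [← cancel_mono (image.ι g)]; simpa using w
  let α : ShortComplex.mk f (factorThruImage g) w₁ ⟶ ShortComplex.mk f g w :=
    { τ₁ := 𝟙 _, τ₂ := 𝟙 _, τ₃ := image.ι g }
  have : Epi α.τ₁ := inferInstanceAs (Epi (𝟙 _))
  have : IsIso α.τ₂ := inferInstanceAs (IsIso (𝟙 _))
  have : Mono α.τ₃ := inferInstanceAs (Mono (image.ι g))
  exact ⟨w₁, (ShortComplex.exact_iff_of_epi_of_isIso_of_mono α).2 h⟩

theorem exists_shortExact_image {X Y Z : C} (f : X ⟶ Y) (g : Y ⟶ Z) (w : f ≫ g = 0)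
    (h : (ShortComplex.mk f g w).Exact) :
    ∃ w', (ShortComplex.mk (image.ι f) (factorThruImage g) w').ShortExact := by
  obtain ⟨w₁, hα⟩ := exact_factorThruImage f g w h
  have w₂ : image.ι f ≫ factorThruImage g = 0 := by
    rw [← cancel_epi (factorThruImage f)]; simpa using w₁
  let β : ShortComplex.mk f (factorThruImage g) w₁ ⟶
      ShortComplex.mk (image.ι f) (factorThruImage g) w₂ :=
    { τ₁ := factorThruImage f, τ₂ := 𝟙 _, τ₃ := 𝟙 _ }
  have : Epi β.τ₁ := inferInstanceAs (Epi (factorThruImage f))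
  have : IsIso β.τ₂ := inferInstanceAs (IsIso (𝟙 _))
  have : Mono β.τ₃ := inferInstanceAs (Mono (𝟙 _))
  exact ⟨w₂, { exact := (ShortComplex.exact_iff_of_epi_of_isIso_of_mono β).1 hα }⟩

/-- `M` has a resolution `0 ⟶ X_n ⟶ ⋯ ⟶ X_0 ⟶ M ⟶ 0` with all `X_i` satisfying `P`. -/
def HasLeftResolution (P : ObjectProperty C) : ℕ → C → Prop
  | 0, M => P M
  | n + 1, M => ∃ S : ShortComplex C, S.ShortExact ∧ P S.X₂ ∧ S.X₃ = M ∧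
      HasLeftResolution P n S.X₁

/-- `M` has a coresolution `0 ⟶ M ⟶ X_0 ⟶ ⋯ ⟶ X_n ⟶ 0` with all `X_i` satisfying `P`. -/
def HasRightResolution (P : ObjectProperty C) : ℕ → C → Prop
  | 0, M => P M
  | n + 1, M => ∃ S : ShortComplex C, S.ShortExact ∧ P S.X₂ ∧ S.X₁ = M ∧
      HasRightResolution P n S.X₃

theorem HasLeftResolution.hasProjectiveDimensionLE {n : ℕ} {M : C}
    (h : HasLeftResolution (fun X : C => Projective X) n M) : HasProjectiveDimensionLE M n := by
  induction n generalizing M with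
  | zero => exact (projective_iff_hasProjectiveDimensionLE_zero _).1 h
  | succ n ih =>
    obtain ⟨S, hS, hP, rfl, hK⟩ := h
    exact (hS.hasProjectiveDimensionLT_X₃_iff n hP).2 (ih hK)

theorem HasRightResolution.hasInjectiveDimensionLE {n : ℕ} {M : C}
    (h : HasRightResolution (fun X : C => Injective X) n M) : HasInjectiveDimensionLE M n := by
  induction n generalizing M with
  | zero => exact injective_iff_hasInjectiveDimensionLT_one.1 h
  | succ n ih =>
    obtain ⟨S, hS, hP, rfl, hK⟩ := h
    exact (hS.hasInjectiveDimensionLT_X₃_iff n hP).1 (ih hK)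

variable [HasExt.{w} C]

/-- Dimension shifting: Ext^j(M, K) lies between Ext^j(M, X_0) and Ext^(j+1) of M into the next
syzygy, whose resolution is one step shorter. -/
theorem HasLeftResolution.subsingleton_ext {P : ObjectProperty C} {n : ℕ} {K : C}
    (h : HasLeftResolution P n K) (M : C) (j : ℕ)
    (hM : ∀ X, P X → ∀ i, j ≤ i → i ≤ j + n → Subsingleton (Ext.{w} M X i)) :
    Subsingleton (Ext.{w} M K j) := by
  induction n generalizing K j with
  | zero => exact hM K h j le_rfl le_rfl
  | succ n ih =>
    obtain ⟨S, hS, hP, rfl, hK⟩ := h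
    have h1 := ih hK (j + 1) fun X hX i h1 h2 => hM X hX i (by lia) (by lia)
    have h2 := hM _ hP j le_rfl (by lia)
    refine subsingleton_of_forall_eq 0 fun x => ?_
    obtain ⟨y, rfl⟩ := Ext.covariant_sequence_exact₃ M hS x rfl (Subsingleton.elim _ _)
    rw [Subsingleton.elim y 0, Ext.zero_comp]

theorem HasRightResolution.subsingleton_ext {P : ObjectProperty C} {n : ℕ} {K : C}
    (h : HasRightResolution P n K) (M : C) (j : ℕ)
    (hM : ∀ X, P X → ∀ i, j ≤ i → i ≤ j + n → Subsingleton (Ext.{w} X M i)) :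
    Subsingleton (Ext.{w} K M j) := by
  induction n generalizing K j with
  | zero => exact hM K h j le_rfl le_rfl
  | succ n ih =>
    obtain ⟨S, hS, hP, rfl, hK⟩ := h
    have h1 := ih hK (j + 1) fun X hX i h1 h2 => hM X hX i (by lia) (by lia)
    have h2 := hM _ hP j le_rfl (by lia)
    refine subsingleton_of_forall_eq 0 fun x => ?_
    obtain ⟨y, rfl⟩ := Ext.contravariant_sequence_exact₁ hS M x (add_comm 1 j)
      (Subsingleton.elim _ _)
    rw [Subsingleton.elim y 0, Ext.comp_zero]

theorem exists_lift_of_subsingleton_ext {S : ShortComplex C} (hS : S.ShortExact) {M : C}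
    (h : Subsingleton (Ext.{w} M S.X₁ 1)) (f : M ⟶ S.X₃) : ∃ l : M ⟶ S.X₂, l ≫ S.g = f := by
  obtain ⟨φ, hφ⟩ := Ext.covariant_sequence_exact₃ M hS (Ext.mk₀ f) (zero_add 1) (by subsingleton)
  obtain ⟨φ, rfl⟩ := Ext.homEquiv₀.symm.surjective φ
  exact ⟨φ, Ext.homEquiv₀.symm.injective (by simpa using hφ)⟩

theorem exists_desc_of_subsingleton_ext {S : ShortComplex C} (hS : S.ShortExact) {M : C}
    (h : Subsingleton (Ext.{w} S.X₃ M 1)) (f : S.X₁ ⟶ M) : ∃ l : S.X₂ ⟶ M, S.f ≫ l = f := by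
  obtain ⟨φ, hφ⟩ := Ext.contravariant_sequence_exact₁ hS M (Ext.mk₀ f) (add_zero 1)
    (by subsingleton)
  obtain ⟨φ, rfl⟩ := Ext.homEquiv₀.symm.surjective φ
  exact ⟨φ, Ext.homEquiv₀.symm.injective (by simpa using hφ)⟩

/-- The obstruction to splitting X_0 ⟶ M is in Ext^1(M, K), where K has a resolution one step
shorter, and dimension shifting kills it. -/
theorem HasLeftResolution.exists_retract {P : ObjectProperty C} {n : ℕ} {M : C}
    (h : HasLeftResolution P n M)
    (hM : ∀ X, P X → ∀ i, 1 ≤ i → i ≤ n → Subsingleton (Ext.{w} M X i)) :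
    ∃ X, P X ∧ Nonempty (Retract M X) := by
  cases n with
  | zero => exact ⟨M, h, ⟨Retract.refl M⟩⟩
  | succ n =>
    obtain ⟨S, hS, hP, rfl, hK⟩ := h
    obtain ⟨l, hl⟩ := exists_lift_of_subsingleton_ext hS
      (hK.subsingleton_ext _ 1 fun X hX i h1 h2 => hM X hX i h1 (by lia)) (𝟙 _)
    exact ⟨_, hP, ⟨⟨l, S.g, hl⟩⟩⟩

theorem HasRightResolution.exists_retract {P : ObjectProperty C} {n : ℕ} {M : C}
    (h : HasRightResolution P n M)
    (hM : ∀ X, P X → ∀ i, 1 ≤ i → i ≤ n → Subsingleton (Ext.{w} X M i)) :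
    ∃ X, P X ∧ Nonempty (Retract M X) := by
  cases n with
  | zero => exact ⟨M, h, ⟨Retract.refl M⟩⟩
  | succ n =>
    obtain ⟨S, hS, hP, rfl, hK⟩ := h
    obtain ⟨l, hl⟩ := exists_desc_of_subsingleton_ext hS
      (hK.subsingleton_ext _ 1 fun X hX i h1 h2 => hM X hX i h1 (by lia)) (𝟙 _)
    exact ⟨_, hP, ⟨⟨S.f, l, hl⟩⟩⟩

theorem subsingleton_ext_one_of_extend {S : ShortComplex C} (hS : S.ShortExact)
    [Projective S.X₂] {N : C} (h : ∀ f : S.X₁ ⟶ N, ∃ l : S.X₂ ⟶ N, S.f ≫ l = f) :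
    Subsingleton (Ext.{w} S.X₃ N 1) := by
  refine subsingleton_of_forall_eq 0 fun x => ?_
  obtain ⟨y, rfl⟩ := Ext.contravariant_sequence_exact₃ hS N x (Ext.eq_zero_of_projective _)
    (add_zero 1)
  obtain ⟨f, rfl⟩ := Ext.homEquiv₀.symm.surjective y
  obtain ⟨l, rfl⟩ := h f
  have h0 : (Ext.homEquiv₀ : Ext.{w} _ _ 0 ≃ _).symm (S.f ≫ l) =
      (Ext.mk₀ S.f).comp (Ext.mk₀ l) (zero_add 0) := (Ext.mk₀_comp_mk₀ _ _).symm
  rw [h0, ShortComplex.ShortExact.extClass_comp_assoc]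

theorem subsingleton_ext_succ {S : ShortComplex C} (hS : S.ShortExact)
    [Projective S.X₂] {N : C} (i : ℕ) (h : Subsingleton (Ext.{w} S.X₁ N i)) :
    Subsingleton (Ext.{w} S.X₃ N (i + 1)) := by
  refine subsingleton_of_forall_eq 0 fun x => ?_
  obtain ⟨y, rfl⟩ := Ext.contravariant_sequence_exact₃ hS N x (Ext.eq_zero_of_projective _)
    (add_comm 1 i)
  rw [Subsingleton.elim y 0, Ext.comp_zero]

theorem subsingleton_ext_of_succ {S : ShortComplex C} (hS : S.ShortExact)
    [Projective S.X₂] {N : C} (i : ℕ) (h : Subsingleton (Ext.{w} S.X₃ N (i + 2))) :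
    Subsingleton (Ext.{w} S.X₁ N (i + 1)) := by
  refine subsingleton_of_forall_eq 0 fun x => ?_
  obtain ⟨y, rfl⟩ := Ext.contravariant_sequence_exact₁ hS N x (add_comm 1 (i + 1))
    (Subsingleton.elim _ _)
  rw [Ext.eq_zero_of_projective y, Ext.comp_zero]

theorem subsingleton_ext_of_succ_of_injective {S : ShortComplex C} (hS : S.ShortExact)
    [Injective S.X₂] {M : C} (i : ℕ) (h : Subsingleton (Ext.{w} M S.X₁ (i + 2))) :
    Subsingleton (Ext.{w} M S.X₃ (i + 1)) := by
  refine subsingleton_of_forall_eq 0 fun x => ?_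
  obtain ⟨y, rfl⟩ := Ext.covariant_sequence_exact₃ M hS x rfl (Subsingleton.elim _ _)
  rw [Ext.eq_zero_of_injective y, Ext.zero_comp]

end Ext

/-! ### Homological dimensions over Noetherian rings. -/

section FiniteModules

open Abelian (Ext)

variable {A : Type v} [Ring A]

theorem finDimModules_iff_finite (k : Type w) [Field k] [Algebra k A] [FiniteDimensional k A]
    (M : ModuleCat.{v} A) : finDimModules k A M ↔ Module.Finite A M := by
  let : Module k M := Module.compHom M (algebraMap k A)
  have : IsScalarTower k A M := ⟨fun c a m => by
    rw [Algebra.smul_def, mul_smul]; rfl⟩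
  constructor
  · intro h
    have h : FiniteDimensional k M := h
    exact Module.Finite.of_restrictScalars_finite k A M
  · intro h
    exact show FiniteDimensional k M from Module.Finite.trans A M

theorem exists_shortExact_finite [IsNoetherianRing A] (M : ModuleCat.{v} A) [Module.Finite A M] :
    ∃ S : ShortComplex (ModuleCat.{v} A), S.ShortExact ∧ S.X₃ = M ∧ Projective S.X₂ ∧
      Module.Finite A S.X₂ ∧ Module.Finite A S.X₁ := by
  obtain ⟨n, f, hf⟩ := Module.Finite.exists_fin' A M
  refine ⟨⟨ModuleCat.ofHom (LinearMap.ker f).subtype, ModuleCat.ofHom f, ?_⟩, ?_, rfl, ?_, ?_, ?_⟩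
  · ext x; exact x.2
  · exact ModuleCat.shortComplex_shortExact _ (LinearMap.exact_subtype_ker_map f)
      Subtype.val_injective hf
  · exact (IsProjective.iff_projective (R := A) (Fin n → A)).1 inferInstance
  · exact inferInstanceAs (Module.Finite A (Fin n → A))
  · exact inferInstanceAs (Module.Finite A (LinearMap.ker f))

/-- Passing to syzygies reduces to n = 0. Then the syzygy of `M` is itself finite projective, so the
vanishing of Ext^1 splits the presentation. -/
theorem hasProjectiveDimensionLE_of_succ [IsNoetherianRing A] (n : ℕ) (M : ModuleCat.{v} A)
    [Module.Finite A M] (hM : HasProjectiveDimensionLE M (n + 1))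
    (h : ∀ P : ModuleCat.{v} A, Module.Finite A P → Projective P →
      Subsingleton (Ext.{v} M P (n + 1))) : HasProjectiveDimensionLE M n := by
  induction n generalizing M with
  | zero =>
    obtain ⟨S, hS, rfl, h2, h2', h1⟩ := exists_shortExact_finite M
    have h1' : HasProjectiveDimensionLE S.X₁ 0 := (hS.hasProjectiveDimensionLT_X₃_iff 0 h2).1 hM
    obtain ⟨l, hl⟩ := exists_lift_of_subsingleton_ext hS
      (h S.X₁ h1 ((projective_iff_hasProjectiveDimensionLE_zero _).2 h1')) (𝟙 _)
    exact (projective_iff_hasProjectiveDimensionLE_zero _).1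
      (Retract.projective ⟨l, S.g, hl⟩)
  | succ n ih =>
    obtain ⟨S, hS, rfl, h2, h2', h1⟩ := exists_shortExact_finite M
    exact (hS.hasProjectiveDimensionLT_X₃_iff n h2).2
      (ih S.X₁ ((hS.hasProjectiveDimensionLT_X₃_iff (n + 1) h2).1 hM)
        fun P hP hP' => subsingleton_ext_of_succ hS n (h P hP hP'))

/-- Passing to injective cosyzygies reduces to n = 0, which is Baer's criterion. -/
theorem hasInjectiveDimensionLE_of_ext (n : ℕ) (N : ModuleCat.{v} A)
    (h : ∀ I : Ideal A, Subsingleton (Ext.{v} (ModuleCat.of A (A ⧸ I)) N (n + 1))) :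
    HasInjectiveDimensionLE N n := by
  induction n generalizing N with
  | zero =>
    refine injective_iff_hasInjectiveDimensionLT_one.1 ?_
    have : Module.Injective A N := Module.Baer.injective fun I g => by
      have hS : (ShortComplex.mk (ModuleCat.ofHom I.subtype) (ModuleCat.ofHom I.mkQ) (by
          ext x; simp)).ShortExact :=
        ModuleCat.shortComplex_shortExact _ (LinearMap.exact_subtype_mkQ I)
          Subtype.val_injective I.mkQ_surjective
      obtain ⟨l, hl⟩ := exists_desc_of_subsingleton_ext hS (h I) (ModuleCat.ofHom g)
      exact ⟨l.hom, fun x hx => ConcreteCategory.congr_hom hl ⟨x, hx⟩⟩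
    exact Module.injective_object_of_injective_module A N
  | succ n ih =>
    let S : ShortComplex (ModuleCat.{v} A) := ShortComplex.mk (Injective.ι N)
      (cokernel.π (Injective.ι N)) (cokernel.condition _)
    have hS : S.ShortExact := { exact := ShortComplex.exact_cokernel _ }
    have : Injective S.X₂ := inferInstanceAs (Injective (Injective.under N))
    exact (hS.hasInjectiveDimensionLT_X₃_iff n this).1
      (ih _ fun I => subsingleton_ext_of_succ_of_injective hS n (h I))

/-- The projective dimension of a finite module is finite, and it is lowered one step at a time to
d, since higher Ext into projectives vanishes. Cyclic modules are finite and detect injective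
dimension, so every module has injective dimension at most d; this bounds all projective dimensions.
-/
theorem globalDimension_le [IsNoetherianRing A] (d : ℕ)
    (hproj : ∀ P : ModuleCat.{v} A, Module.Finite A P → Projective P →
      HasInjectiveDimensionLE P d) (hA : globalDimension A < ⊤) : globalDimension A ≤ d := by
  have hfin (M : ModuleCat.{v} A) (hM : Module.Finite A M) : HasProjectiveDimensionLE M d := by
    obtain ⟨n, hn⟩ : ∃ n, HasProjectiveDimensionLE M (d + n) := by
      obtain ⟨n, hn⟩ := (projectiveDimension_ne_top_iff M).1
        ((le_iSup projectiveDimension M).trans_lt hA).ne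
      exact ⟨n, hasProjectiveDimensionLT_of_ge M (n + 1) _ (by lia)⟩
    induction n with
    | zero => exact hn
    | succ n ih =>
      refine ih (hasProjectiveDimensionLE_of_succ (d + n) M hn fun P hP hP' => ?_)
      have := hproj P hP hP'
      exact HasInjectiveDimensionLT.subsingleton P (d + 1) _ (by lia) M
  have hinj (N : ModuleCat.{v} A) : HasInjectiveDimensionLE N d :=
    hasInjectiveDimensionLE_of_ext d N fun I => by
      have := hfin (ModuleCat.of A (A ⧸ I)) (inferInstanceAs (Module.Finite A (A ⧸ I)))
      exact HasProjectiveDimensionLT.subsingleton _ (d + 1) _ le_rfl N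
  refine iSup_le fun M => (projectiveDimension_le_iff M d).2 ?_
  rw [HasProjectiveDimensionLE, hasProjectiveDimensionLT_iff.{v}]
  intro i hi N e
  have := hinj N
  exact e.eq_zero_of_hasInjectiveDimensionLT _ hi

end FiniteModules

attribute [local instance] hasBinaryBiproducts_of_finite_biproducts

/-! ### Additive closures. -/

section Add

variable {C : Type u} [Category.{v} C] [Preadditive C] [HasFiniteBiproducts C]

theorem additive_of_isEquivalence {D : Type*} [Category D] [Preadditive D] (F : C ⥤ D)
    [F.IsEquivalence] : F.Additive :=
  have := preservesBinaryBiproducts_of_preservesBinaryProducts F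
  Functor.additive_of_preservesBinaryBiproducts F

theorem add_self (T : C) : add T T :=
  ⟨1, ⟨⟨biproduct.ι (fun _ : Fin 1 => T) 0, biproduct.π (fun _ : Fin 1 => T) 0, by simp⟩⟩⟩

theorem add_biproduct (T : C) (n : ℕ) : add T (⨁ fun _ : Fin n => T) :=
  ⟨n, ⟨Retract.refl _⟩⟩

theorem add_of_iso {T X Y : C} (hX : add T X) (e : X ≅ Y) : add T Y := by
  obtain ⟨n, ⟨r⟩⟩ := hX
  exact ⟨n, ⟨(Retract.ofIso e.symm).trans r⟩⟩

theorem eq_zero_of_add_left {T X Y : C} (hX : add T X) (h : ∀ f : T ⟶ Y, f = 0) (f : X ⟶ Y) :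
    f = 0 := by
  obtain ⟨n, ⟨r⟩⟩ := hX
  have : r.r ≫ f = 0 := biproduct.hom_ext' _ _ fun j => (h _).trans (h _).symm
  rw [← Category.id_comp f, ← r.retract, Category.assoc, this, comp_zero]

theorem eq_zero_of_add_right {T X Y : C} (hX : add T X) (h : ∀ f : Y ⟶ T, f = 0) (f : Y ⟶ X) :
    f = 0 := by
  obtain ⟨n, ⟨r⟩⟩ := hX
  have : f ≫ r.i = 0 := biproduct.hom_ext _ _ fun j => (h _).trans (h _).symm
  rw [← Category.comp_id f, ← r.retract, reassoc_of% this, zero_comp]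

theorem add_map {D : Type*} [Category D] [Preadditive D] [HasFiniteBiproducts D] (F : C ⥤ D)
    [F.Additive] {T X : C} (hX : add T X) : add (F.obj T) (F.obj X) := by
  obtain ⟨n, ⟨r⟩⟩ := hX
  exact ⟨n, ⟨(r.map F).trans (Retract.ofIso (F.mapBiproduct _))⟩⟩

theorem projective_of_add {P X : C} (hX : add P X) (hP : Projective P) : Projective X := by
  obtain ⟨n, ⟨r⟩⟩ := hX
  have : Projective (⨁ fun _ : Fin n => P) :=
    { factors := fun f e _ => ⟨biproduct.desc fun j =>
        Projective.factorThru (biproduct.ι (fun _ : Fin n => P) j ≫ f) e, by cat_disch⟩ }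
  exact r.projective

theorem injective_of_add {I X : C} (hX : add I X) (hI : Injective I) : Injective X := by
  obtain ⟨n, ⟨r⟩⟩ := hX
  have : Injective (⨁ fun _ : Fin n => I) :=
    { factors := fun g f _ => ⟨biproduct.lift fun j =>
        Injective.factorThru (g ≫ biproduct.π (fun _ : Fin n => I) j) f, by
          refine biproduct.hom_ext _ _ fun j => ?_
          simp⟩ }
  exact r.injective

end Add

/-! ### Projective modules from `add T`. -/

section HomFunctor

variable {C : Type u} [Category.{v} C] [Preadditive C]

theorem homFunctor_exact (T : C) {X Y Z : C} {f : X ⟶ Y} {g : Y ⟶ Z} (h : HomExact f g) :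
    ∃ w, (ShortComplex.mk ((homFunctor T).map f) ((homFunctor T).map g) w).Exact := by
  refine ⟨by rw [← Functor.map_comp, h.zero, Functor.map_zero], ?_⟩
  rw [ShortComplex.moduleCat_exact_iff]
  exact fun x hx => h.exists_lift (W := T) x hx

/-- The module homomorphism `Hom(T, T) ⟶ M` which maps the identity to `m`. -/
def homFunctorDesc (T : C) {M : ModuleCat.{v} (EndOp T)} (m : M) : (homFunctor T).obj T ⟶ M :=
  ModuleCat.ofHom
    { toFun := fun t => MulOpposite.op (show End T from t) • m
      map_add' := fun s t => by
        rw [← add_smul]; rfl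
      map_smul' := fun a t => by
        simp only [RingHom.id_apply]
        rw [smul_smul]; rfl }

theorem projective_homFunctor_self (T : C) : Projective ((homFunctor T).obj T) where
  factors {E X} f e _ := by
    obtain ⟨m, hm⟩ := (ModuleCat.epi_iff_surjective e).1 inferInstance (f (𝟙 T))
    refine ⟨homFunctorDesc T m, ?_⟩
    refine ModuleCat.hom_ext (LinearMap.ext fun t => ?_)
    change e (MulOpposite.op (show End T from t) • m) = f t
    rw [map_smul, hm]
    exact (map_smul f.hom _ _).symm.trans (congrArg f (Category.comp_id _))

variable [HasFiniteBiproducts C]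

theorem projective_homFunctor {T X : C} (hX : add T X) : Projective ((homFunctor T).obj X) := by
  exact projective_of_add (add_map (homFunctor T) hX) (projective_homFunctor_self T)

/-- Yoneda: a homomorphism out of Hom(T, T^n) is determined by its values on the n inclusions of T,
and these assemble to a morphism out of T^n. -/
theorem exists_map_eq_of_add {T X Y : C} (hX : add T X)
    (φ : (homFunctor T).obj X ⟶ (homFunctor T).obj Y) :
    ∃ f : X ⟶ Y, (homFunctor T).map f = φ := by
  have key (n : ℕ) (φ : (homFunctor T).obj (⨁ fun _ : Fin n => T) ⟶ (homFunctor T).obj Y) :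
      ∃ f, (homFunctor T).map f = φ := by
    let ψ (j : Fin n) : T ⟶ Y := φ (biproduct.ι (fun _ : Fin n => T) j)
    refine ⟨biproduct.desc ψ, ModuleCat.hom_ext (LinearMap.ext fun t => ?_)⟩
    change T ⟶ ⨁ fun _ : Fin n => T at t
    have ht : t = ∑ j, (t ≫ biproduct.π _ j) ≫ biproduct.ι (fun _ : Fin n => T) j := by
      simp only [Category.assoc, ← Preadditive.comp_sum, biproduct.total, Category.comp_id]
    have h1 : t ≫ biproduct.desc ψ = ∑ j, (t ≫ biproduct.π _ j) ≫ ψ j := by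
      rw [biproduct.desc_eq, Preadditive.comp_sum]
      simp only [Category.assoc]
    refine h1.trans ?_
    conv_rhs => rw [ht]
    refine Eq.trans ?_ (map_sum φ.hom _ _).symm
    exact Finset.sum_congr rfl fun j _ =>
      (map_smul φ.hom (MulOpposite.op (show End T from t ≫ biproduct.π _ j))
        (biproduct.ι (fun _ : Fin n => T) j)).symm
  obtain ⟨n, ⟨r⟩⟩ := hX
  obtain ⟨f, hf⟩ := key n ((homFunctor T).map r.r ≫ φ)
  exact ⟨r.i ≫ f, by rw [Functor.map_comp, hf, ← Functor.map_comp_assoc, r.retract,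
    CategoryTheory.Functor.map_id, Category.id_comp]⟩

theorem eq_zero_of_map_eq_zero {T X Y : C} (hX : add T X) {f : X ⟶ Y}
    (hf : (homFunctor T).map f = 0) : f = 0 := by
  obtain ⟨n, ⟨r⟩⟩ := hX
  have h0 (t : T ⟶ X) : t ≫ f = 0 := ConcreteCategory.congr_hom hf t
  have : r.r ≫ f = 0 := biproduct.hom_ext' _ _ fun j => by
    rw [← Category.assoc, h0, comp_zero]
  rw [← Category.id_comp f, ← r.retract, Category.assoc, this, comp_zero]

theorem exists_epi_homFunctor {T : C} (M : ModuleCat.{v} (EndOp T)) [Module.Finite (EndOp T) M] :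
    ∃ (X : C) (_ : add T X) (f : (homFunctor T).obj X ⟶ M), Epi f := by
  obtain ⟨n, f, hf⟩ := Module.Finite.exists_fin' (EndOp T) M
  let g : (homFunctor T).obj (⨁ fun _ : Fin n => T) ⟶ M := ModuleCat.ofHom
    (f ∘ₗ LinearMap.pi fun j =>
      { toFun := fun t => MulOpposite.op (show End T from (show T ⟶ _ from t) ≫ biproduct.π _ j)
        map_add' := fun s t => congrArg MulOpposite.op (Preadditive.add_comp _ _ _ _ _ _)
        map_smul' := fun a t => congrArg MulOpposite.op (Category.assoc _ _ _) })
  refine ⟨_, add_biproduct T n, g, (ModuleCat.epi_iff_surjective g).2 fun m => ?_⟩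
  obtain ⟨a, rfl⟩ := hf m
  refine ⟨biproduct.lift fun j => (a j).unop, congrArg f (funext fun j => ?_)⟩
  exact congrArg MulOpposite.op (biproduct.lift_π _ j)

end HomFunctor

/-! ### Lifting idempotents and closure under retracts. -/

section Idempotents

/-- The powers of `r` stabilize up to multiples: r^n = r^(n+1) y, hence r^n = r^(n+j) y^j for all j.
So r^N y^N is idempotent for N = n + 1. Nothing is required of the kernel of `g`. -/
theorem exists_isIdempotentElem_map_eq_of_isArtinianRing {R B : Type*} [CommRing R]
    [IsArtinianRing R] [Ring B] (g : R →+* B) (r : R) (hr : IsIdempotentElem (g r)) :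
    ∃ e : R, IsIdempotentElem e ∧ g e = g r := by
  obtain ⟨n, y, hy⟩ := IsArtinian.exists_pow_succ_smul_dvd r (1 : R)
  rw [smul_eq_mul, smul_eq_mul, mul_one] at hy
  have hpow (j : ℕ) : r ^ (n + j) * y ^ j = r ^ n := by
    induction j with
    | zero => simp
    | succ j ih =>
      calc r ^ (n + (j + 1)) * y ^ (j + 1) = r ^ j * y ^ j * (r ^ (n + 1) * y) := by ring
        _ = r ^ (n + j) * y ^ j := by rw [hy]; ring
        _ = r ^ n := ih
  have h0 : r ^ (n + 1) * r ^ (n + 1) * y ^ (n + 1) = r ^ (n + 1) := by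
    calc _ = r * (r ^ (n + (n + 1)) * y ^ (n + 1)) := by ring
      _ = _ := by rw [hpow]; ring
  -- The exponent is n + 1 and not n because n may be 0, and g(r)^N = g(r) needs N positive.
  refine ⟨r ^ (n + 1) * y ^ (n + 1), ?_, ?_⟩
  · calc r ^ (n + 1) * y ^ (n + 1) * (r ^ (n + 1) * y ^ (n + 1)) =
          (r ^ (n + 1) * r ^ (n + 1) * y ^ (n + 1)) * y ^ (n + 1) := by ring
      _ = _ := by rw [h0]
  · have h1 := congrArg g h0
    have h2 : g r ^ (n + 1) = g r := hr.pow_succ_eq n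
    simp only [map_mul, map_pow, h2, hr.eq] at h1
    rw [map_mul, map_pow, map_pow, h2, h1]

/-- The subalgebra k[b] is commutative and Artinian, which reduces to the commutative case. -/
theorem exists_isIdempotentElem_map_eq (k : Type*) [Field k] {B B' : Type*} [Ring B] [Algebra k B]
    [FiniteDimensional k B] [Ring B'] (f : B →+* B') (b : B) (hb : IsIdempotentElem (f b)) :
    ∃ e : B, IsIdempotentElem e ∧ f e = f b := by
  have := Algebra.isMulCommutative_adjoin k (s := {b}) (by rintro x rfl y rfl; rfl)
  have : IsArtinianRing (Algebra.adjoin k {b}) := isArtinian_of_tower k inferInstance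
  obtain ⟨e, he, hfe⟩ := exists_isIdempotentElem_map_eq_of_isArtinianRing
    (f.comp (Algebra.adjoin k {b}).val.toRingHom)
    ⟨b, Algebra.self_mem_adjoin_singleton k b⟩ hb
  exact ⟨e, congrArg Subtype.val he, hfe⟩

end Idempotents

section RetractClosure

variable {k : Type w} [Field k] {C : Type u} [Category.{v} C] [Preadditive C] [Linear k C]
  [IsIdempotentComplete C]

/-- The essential image of a full additive functor on a `Hom`-finite category with split idempotents
is closed under retracts. -/
theorem essImage_of_retract {D : Type*} [Category D] [Preadditive D] (F : C ⥤ D) [F.Full]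
    [F.Additive] (hfin : ∀ X Y : C, FiniteDimensional k (X ⟶ Y)) {M N : D} (r : Retract M N)
    (hN : F.essImage N) : F.essImage M := by
  obtain ⟨X, ⟨i⟩⟩ := hN
  have : FiniteDimensional k (End X) := hfin X X
  let r' : Retract M (F.obj X) := r.trans (Retract.ofIso i.symm)
  obtain ⟨b, hb⟩ := F.map_surjective (r'.r ≫ r'.i)
  let f : End X →+* End (F.obj X) :=
    { toFun := fun x => F.map x
      map_one' := F.map_id X
      map_mul' := fun x y => F.map_comp y x
      map_zero' := F.map_zero X X
      map_add' := fun x y => F.map_add }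
  -- The retract defines an idempotent of `F.obj X`. It lifts to an idempotent of `X`, whose
  -- splitting `Y` satisfies F(Y) ≅ M.
  obtain ⟨e, he, hfe⟩ := exists_isIdempotentElem_map_eq k f b (by
    change F.map b ≫ F.map b = F.map b
    rw [hb]; simp)
  obtain ⟨Y, p, q, hpq, hqp⟩ := IsIdempotentComplete.idempotents_split X e he
  have hFe : F.map (q ≫ p) = r'.r ≫ r'.i := by
    rw [hqp, ← hb]; exact hfe
  refine ⟨Y, ⟨⟨F.map p ≫ r'.r, r'.i ≫ F.map q, ?_, ?_⟩⟩⟩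
  · rw [Category.assoc, ← Category.assoc r'.r, ← hFe, ← F.map_comp, ← F.map_comp, ← F.map_id]
    congr 1
    simp [hpq]
  · rw [Category.assoc, ← Category.assoc (F.map q), ← F.map_comp, hFe]
    simp

end RetractClosure

/-! ### Injective modules from `add (R T)`. -/

section Injectives

variable {k : Type w} [Field k] {C : Type u} [Category.{v} C] [Preadditive C] [Linear k C]
  (R : SerreFunctor k C) (T : C)

namespace SerreFunctor

/-- The trace form on `Hom(T, R T)`. -/
def trace : (T ⟶ R.functor.obj T) →ₗ[k] k :=
  LinearMap.applyₗ (𝟙 T) ∘ₗ (R.iso T T).symm.toLinearMap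

/-- Makes (g, s) ↦ trace(g ≫ s) a perfect pairing, so Hom(T, R T) behaves as the k-dual of Γ. -/
theorem trace_comp (g : T ⟶ T) (s : T ⟶ R.functor.obj T) :
    R.trace T (g ≫ s) = (R.iso T T).symm s g := by
  obtain ⟨φ, rfl⟩ := (R.iso T T).surjective s
  rw [← R.naturality_right]
  simp [trace]

theorem hom_ext_trace {s t : T ⟶ R.functor.obj T}
    (h : ∀ g : T ⟶ T, R.trace T (g ≫ s) = R.trace T (g ≫ t)) : s = t := by
  apply (R.iso T T).symm.injective
  ext g
  rw [← trace_comp, ← trace_comp, h]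

theorem exists_trace_comp_eq (φ : Module.Dual k (T ⟶ T)) :
    ∃ s : T ⟶ R.functor.obj T, ∀ g : T ⟶ T, R.trace T (g ≫ s) = φ g :=
  ⟨R.iso T T φ, fun g => by rw [trace_comp, LinearEquiv.symm_apply_apply]⟩

/-- Each linear form on a module is the composition of a homomorphism to `Hom(T, R T)` with the
trace form. -/
theorem exists_hom_trace {M : Type v} [AddCommGroup M] [Module (EndOp T) M] [Module k M]
    [IsScalarTower k (EndOp T) M] (l : Module.Dual k M) :
    ∃ f : M →ₗ[EndOp T] (homFunctor T).obj (R.functor.obj T),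
      ∀ m, R.trace T (f m) = l m := by
  have key (m : M) := R.exists_trace_comp_eq T
    { toFun := fun g => l (MulOpposite.op (show End T from g) • m)
      map_add' := fun g h => by rw [← map_add, ← add_smul]; rfl
      map_smul' := fun c g => by
        simp only [RingHom.id_apply]
        rw [← map_smul, ← smul_assoc]; rfl }
  choose f hf using key
  refine ⟨{ toFun := f, map_add' := fun x y => ?_, map_smul' := fun a x => ?_ }, fun m => ?_⟩
  · apply R.hom_ext_trace
    intro g
    change _ = R.trace T (g ≫ (f x + f y))
    rw [hf, Preadditive.comp_add, map_add, hf, hf]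
    simp
  · apply R.hom_ext_trace
    intro g
    change _ = R.trace T (g ≫ (show T ⟶ T from a.unop) ≫ f x)
    rw [hf, ← Category.assoc, hf]
    simp only [LinearMap.coe_mk, AddHom.coe_mk]
    rw [smul_smul]; rfl
  · have := hf m (𝟙 T)
    rw [Category.id_comp] at this
    refine this.trans ?_
    exact congrArg l (one_smul _ _)

/-- By the trace, homomorphisms into Hom(T, R T) are linear forms, and forms extend along the
injection `i` through a k-linear retraction. -/
theorem injective_homFunctor : Injective ((homFunctor T).obj (R.functor.obj T)) where
  factors {M N} f i _ := by
    let _ : Module k M := Module.compHom M (algebraMap k (EndOp T))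
    let _ : Module k N := Module.compHom N (algebraMap k (EndOp T))
    have : IsScalarTower k (EndOp T) M := ⟨fun c a m => by
      rw [Algebra.smul_def, mul_smul]; rfl⟩
    have : IsScalarTower k (EndOp T) N := ⟨fun c a m => by
      rw [Algebra.smul_def, mul_smul]; rfl⟩
    let ik : M →ₗ[k] N := i.hom.restrictScalars k
    let lk : Module.Dual k M :=
      { toFun := fun m => R.trace T (f m)
        map_add' := fun x y => by rw [map_add]; exact map_add _ _ _
        map_smul' := fun c x => by
          have h1 : f (c • x) = (c • (show T ⟶ R.functor.obj T from f x)) :=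
            (map_smul f.hom (algebraMap k (EndOp T) c) x).trans (by
              change (c • 𝟙 T) ≫ (show T ⟶ R.functor.obj T from f x) = _
              rw [Linear.smul_comp, Category.id_comp])
          rw [h1]
          exact map_smul _ _ _ }
    obtain ⟨p, hp⟩ := LinearMap.exists_leftInverse_of_injective ik
      (LinearMap.ker_eq_bot.2 ((ModuleCat.mono_iff_injective i).1 inferInstance))
    obtain ⟨h, hh⟩ := R.exists_hom_trace T (lk ∘ₗ p)
    refine ⟨ModuleCat.ofHom h, ModuleCat.hom_ext (LinearMap.ext fun m => ?_)⟩
    apply R.hom_ext_trace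
    intro g
    have h1 : g ≫ (show T ⟶ R.functor.obj T from h (i m)) =
        h (i (MulOpposite.op (show End T from g) • m)) := by
      rw [map_smul, map_smul]; rfl
    have h2 : g ≫ (show T ⟶ R.functor.obj T from f m) =
        f (MulOpposite.op (show End T from g) • m) := by
      rw [map_smul]; rfl
    refine (congrArg _ h1).trans (Eq.trans ?_ (congrArg _ h2).symm)
    rw [hh]
    exact congrArg lk (LinearMap.congr_fun hp _)

variable [HasFiniteBiproducts C]

instance : R.functor.Additive := additive_of_isEquivalence _

theorem injective_homFunctor_of_add {X : C} (hX : add T X) :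
    Injective ((homFunctor T).obj (R.functor.obj X)) :=
  injective_of_add (add_map (R.functor ⋙ homFunctor T) hX) (R.injective_homFunctor T)

/-- Each coordinate form of a k-basis of `M` is the trace of a homomorphism to Hom(T, R T). Together
these are injective, since the traces recover the coordinates. -/
theorem exists_mono_homFunctor (hfin : FiniteDimensional k (T ⟶ T))
    (M : ModuleCat.{v} (EndOp T)) [Module.Finite (EndOp T) M] :
    ∃ (X : C) (_ : add (R.functor.obj T) X) (f : M ⟶ (homFunctor T).obj X), Mono f := by
  have : FiniteDimensional k (EndOp T) :=
    Module.Finite.equiv (MulOpposite.opLinearEquiv k : (T ⟶ T) ≃ₗ[k] (T ⟶ T)ᵐᵒᵖ)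
  let _ : Module k M := Module.compHom M (algebraMap k (EndOp T))
  have : IsScalarTower k (EndOp T) M := ⟨fun c a m => by
    rw [Algebra.smul_def, mul_smul]; rfl⟩
  have : FiniteDimensional k M := Module.Finite.trans (EndOp T) M
  let b := Module.finBasis k M
  choose f hf using fun i => R.exists_hom_trace T (b.coord i)
  let l (m : M) : T ⟶ ⨁ fun _ : Fin (Module.finrank k M) => R.functor.obj T :=
    biproduct.lift fun i => (f i m : T ⟶ R.functor.obj T)
  have hl (m : M) (i) : l m ≫ biproduct.π _ i = (f i m : T ⟶ R.functor.obj T) :=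
    biproduct.lift_π _ _
  let g : M ⟶ (homFunctor T).obj (⨁ fun _ : Fin (Module.finrank k M) => R.functor.obj T) :=
    ModuleCat.ofHom
      { toFun := l
        map_add' := fun x y => biproduct.hom_ext _ _ fun j =>
          (hl _ _).trans ((map_add (f j) x y).trans ((congrArg₂ (· + ·) (hl _ _).symm
            (hl _ _).symm).trans (Preadditive.add_comp _ _ _ _ _ _).symm))
        map_smul' := fun a x => biproduct.hom_ext _ _ fun j =>
          (hl _ _).trans ((map_smul (f j) a x).trans ((congrArg (a • ·) (hl _ _).symm).trans
            (Category.assoc (show T ⟶ T from a.unop) _ _).symm)) }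
  refine ⟨_, add_biproduct _ _, g, (ModuleCat.mono_iff_injective g).2 ?_⟩
  intro x y hxy
  refine b.ext_elem fun i => ?_
  have h1 : f i x = f i y :=
    (hl x i).symm.trans ((congrArg (fun z : T ⟶ ⨁ fun _ => R.functor.obj T =>
      z ≫ biproduct.π _ i) hxy).trans (hl y i))
  have h2 := (hf i x).symm.trans ((congrArg (R.trace T) h1).trans (hf i y))
  exact h2

end SerreFunctor

end Injectives

/-! ### Transport along isomorphisms, and image factorizations. -/

section ResolutionIso

open Abelian (Ext)

variable {D : Type u} [Category.{v} D] [Abelian D]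

theorem HasLeftResolution.of_iso {P : ObjectProperty D} [P.IsClosedUnderIsomorphisms] {n : ℕ}
    {M N : D} (h : HasLeftResolution P n M) (e : M ≅ N) : HasLeftResolution P n N := by
  cases n with
  | zero => exact P.prop_of_iso e h
  | succ n =>
    obtain ⟨S, hS, hP, rfl, hK⟩ := h
    exact ⟨ShortComplex.mk S.f (S.g ≫ e.hom) (by rw [reassoc_of% S.zero, zero_comp]),
      ShortComplex.shortExact_of_iso
        (ShortComplex.isoMk (S₁ := S) (Iso.refl _) (Iso.refl _) e (by simp) (by simp)) hS,
      hP, rfl, hK⟩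

theorem HasRightResolution.of_iso {P : ObjectProperty D} [P.IsClosedUnderIsomorphisms] {n : ℕ}
    {M N : D} (h : HasRightResolution P n M) (e : M ≅ N) : HasRightResolution P n N := by
  cases n with
  | zero => exact P.prop_of_iso e h
  | succ n =>
    obtain ⟨S, hS, hP, rfl, hK⟩ := h
    exact ⟨ShortComplex.mk (e.inv ≫ S.f) S.g (by rw [Category.assoc, S.zero, comp_zero]),
      ShortComplex.shortExact_of_iso
        (ShortComplex.isoMk (S₁ := S) e (Iso.refl _) (Iso.refl _) (by simp) (by simp)) hS, hP, rfl, hK⟩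

theorem subsingleton_ext_of_iso [HasExt.{w} D] {M M' N N' : D} (e : M ≅ M') (e' : N ≅ N') {i : ℕ}
    (h : Subsingleton (Ext.{w} M' N' i)) : Subsingleton (Ext.{w} M N i) := by
  refine subsingleton_of_forall_eq 0 fun x => ?_
  have h0 : (Ext.mk₀ e.inv).comp (x.comp (Ext.mk₀ e'.hom) (add_zero i)) (zero_add i) = 0 :=
    Subsingleton.elim _ _
  have h1 := congrArg (fun z => (Ext.mk₀ e.hom).comp z (zero_add i)) h0
  simp only [Ext.mk₀_comp_mk₀_assoc, Iso.hom_inv_id, Ext.mk₀_id_comp, Ext.comp_zero] at h1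
  have h2 := congrArg (fun z => z.comp (Ext.mk₀ e'.inv) (add_zero i)) h1
  simpa [Ext.comp_assoc_of_third_deg_zero] using h2

/-- The factorization of a weak kernel through the kernel is an epimorphism. -/
theorem exists_epi_of_exact {M X Y Z : D} {i : M ⟶ Y} [Mono i] {f : X ⟶ Y} {g : Y ⟶ Z}
    {w : i ≫ g = 0} {w' : f ≫ g = 0} (hi : (ShortComplex.mk i g w).Exact)
    (hf : (ShortComplex.mk f g w').Exact) : ∃ q : X ⟶ M, Epi q ∧ q ≫ i = f := by
  have : Mono (ShortComplex.mk i g w).f := ‹Mono i›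
  have hq : hi.lift f w' ≫ i = f := hi.lift_f f w'
  refine ⟨hi.lift f w', ?_, hq⟩
  rw [epi_iff_surjective_up_to_refinements]
  intro A y
  obtain ⟨A', π, hπ, x, hx⟩ := hf.exact_up_to_refinements (y ≫ i) (by simp [w])
  refine ⟨A', π, hπ, x, ?_⟩
  rw [← cancel_mono i, Category.assoc, Category.assoc, hq]
  exact hx

/-- The factorization of a weak cokernel through the cokernel is a monomorphism. -/
theorem exists_mono_of_exact {M X Y Z : D} {f : X ⟶ Y} {q : Y ⟶ M} [Epi q] {g : Y ⟶ Z}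
    {w : f ≫ q = 0} {w' : f ≫ g = 0} (hq : (ShortComplex.mk f q w).Exact)
    (hg : (ShortComplex.mk f g w').Exact) : ∃ i : M ⟶ Z, Mono i ∧ q ≫ i = g := by
  have : Epi (ShortComplex.mk f q w).g := ‹Epi q›
  have hi : q ≫ hq.desc g w' = g := hq.g_desc g w'
  refine ⟨hq.desc g w', ?_, hi⟩
  rw [Preadditive.mono_iff_cancel_zero]
  intro A a ha
  obtain ⟨A', π, hπ, x, hx⟩ := surjective_up_to_refinements_of_epi q a
  obtain ⟨A'', π', hπ', y, hy⟩ := hg.exact_up_to_refinements x (by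
    change x ≫ g = 0
    rw [← hi, ← reassoc_of% hx, ha, comp_zero])
  change _ = y ≫ f at hy
  rw [← cancel_epi π, ← cancel_epi π', comp_zero, comp_zero, hx, reassoc_of% hy, w, comp_zero]

/-- An object with an epimorphism from `X` and a monomorphism to `Y` is the image of the
composition. -/
def isoImage {M X Y : D} (q : X ⟶ M) (i : M ⟶ Y) [Epi q] [Mono i] {f : X ⟶ Y} (h : q ≫ i = f) :
    M ≅ image f :=
  have := strongEpi_of_epi q
  image.isoStrongEpiMono q i h

end ResolutionIso

/-! ### Resolutions obtained from angles. -/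

section Angles

variable {C : Type u} [Category.{v} C] [Preadditive C] [HasFiniteBiproducts C] {d : ℕ}
  {S : C ⥤ C} [S.IsEquivalence] {D : Type*} [Category.{v} D] [Abelian D]

/-- `G` maps weak kernels to exact sequences. -/
def IsWeaklyExact (G : C ⥤ D) : Prop :=
  ∀ ⦃X Y Z : C⦄ ⦃f : X ⟶ Y⦄ ⦃g : Y ⟶ Z⦄, HomExact f g →
    ∃ w, (ShortComplex.mk (G.map f) (G.map g) w).Exact

namespace Angulation

variable (𝒜 : Angulation C S d) {G : C ⥤ D} (hG : IsWeaklyExact G) {A : SigmaSeq C S d}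
  (hA : A ∈ 𝒜.angles)

include hG hA

theorem exists_shortExact (j : ℕ) (hj : j + 1 < d + 1) :
    ∃ w, (ShortComplex.mk (image.ι (G.map (A.m (j + 1) hj)))
      (factorThruImage (G.map (A.m j (by lia)))) w).ShortExact := by
  obtain ⟨w, h⟩ := hG (𝒜.homExact_m hA j hj)
  exact exists_shortExact_image _ _ w h

theorem epi_map_m_zero (hd : 1 ≤ d) (h : G.map A.c = 0) : Epi (G.map (A.m 0 (by lia))) := by
  obtain ⟨w, h'⟩ := hG (𝒜.homExact_conn hd hA)
  exact h'.epi_f h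

/-- Splices the short exact sequences of consecutive images along the angle, starting at its left
end. -/
theorem hasLeftResolution_image (P : ObjectProperty D)
    (hP : ∀ i (hi : i < d), P (G.obj (A.o (i + 1) (by lia))))
    (hd : P (image (G.map (A.m d (by lia))))) (n j : ℕ) (hj : j + n = d) :
    HasLeftResolution P n (image (G.map (A.m j (by lia)))) := by
  induction n generalizing j with
  | zero =>
    obtain rfl : j = d := hj
    exact hd
  | succ n ih =>
    obtain ⟨w, h⟩ := 𝒜.exists_shortExact hG hA j (by lia)
    exact ⟨_, h, hP j (by lia), rfl, ih (j + 1) (by lia)⟩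

theorem hasRightResolution_image (P : ObjectProperty D) (j : ℕ)
    (hP : ∀ i (hi : i < d), j ≤ i → P (G.obj (A.o (i + 1) (by lia)))) (hj : j < d + 1)
    (h0 : P (image (G.map (A.m j hj)))) (n l : ℕ) (hl : l < d + 1) (hn : j + n = l) :
    HasRightResolution P n (image (G.map (A.m l hl))) := by
  induction n generalizing l with
  | zero =>
    obtain rfl : j = l := hn
    exact h0
  | succ n ih =>
    obtain rfl : j + n + 1 = l := hn
    obtain ⟨w, h⟩ := 𝒜.exists_shortExact hG hA (j + n) hl
    exact ⟨_, h, hP _ (by lia) (by lia), rfl, ih _ (by lia) rfl⟩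

end Angulation

omit [HasFiniteBiproducts C] in
theorem isWeaklyExact_homFunctor (T : C) : IsWeaklyExact (homFunctor T) :=
  fun _ _ _ _ _ h => homFunctor_exact T h

omit [HasFiniteBiproducts C] in
theorem IsWeaklyExact.comp {G : C ⥤ D} (hG : IsWeaklyExact G) (F : C ⥤ C) [F.IsEquivalence] :
    IsWeaklyExact (F ⋙ G) :=
  fun _ _ _ _ _ h => hG (h.map F)

end Angles

/-! ### Fullness and the quotient by `add (S.obj T)`. -/

namespace Angulation

open Abelian (Ext)

namespace IsClusterTilting

section Functor

variable {k : Type w} [Field k] {C : Type u} [Category.{v} C] [Preadditive C] [Linear k C]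
  [HasFiniteBiproducts C] {d : ℕ} {S : C ⥤ C} [S.IsEquivalence] {𝒜 : Angulation C S d} {T : C}

theorem hom_shift_eq_zero (hT : 𝒜.IsClusterTilting T) {X Y : C} (hX : add T X) (hY : add T Y)
    (f : X ⟶ S.obj Y) : f = 0 := by
  have := additive_of_isEquivalence S
  exact eq_zero_of_add_left hX
    (eq_zero_of_add_right (add_map S hY) hT.hom_eq_zero) f

omit [S.IsEquivalence] in
theorem map_eq_zero_of_add (hT : 𝒜.IsClusterTilting T) {X Y Z : C} (hZ : add (S.obj T) Z)
    (a : X ⟶ Z) (b : Z ⟶ Y) : (homFunctor T).map (a ≫ b) = 0 := by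
  refine ModuleCat.hom_ext (LinearMap.ext fun t => ?_)
  change T ⟶ X at t
  change t ≫ a ≫ b = 0
  rw [← Category.assoc, eq_zero_of_add_right hZ hT.hom_eq_zero (t ≫ a), zero_comp]

theorem epi_map_m_zero (hT : 𝒜.IsClusterTilting T) (hd : 1 ≤ d) {A : SigmaSeq C S d}
    (hA : A ∈ 𝒜.angles) (h : add T (A.o (d + 1) (by lia))) :
    Epi ((homFunctor T).map (A.m 0 (by lia))) := by
  refine 𝒜.epi_map_m_zero (isWeaklyExact_homFunctor T) hA hd
    (ModuleCat.hom_ext (LinearMap.ext fun t => ?_))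
  exact hT.hom_shift_eq_zero (add_self T) h (show T ⟶ _ from t ≫ A.c)

/-- Such an `f` vanishes on T_0 ⟶ X, and X ⟶ ΣT_d is a weak cokernel of that map. -/
theorem exists_factor_of_map_eq_zero (hT : 𝒜.IsClusterTilting T) (hd : 1 ≤ d)
    (R : SerreFunctor k C) {X Y : C} {f : X ⟶ Y} (hf : (homFunctor T).map f = 0) :
    ∃ (Z : C) (_ : add (S.obj T) Z) (a : X ⟶ Z) (b : Z ⟶ Y), f = a ≫ b := by
  have := additive_of_isEquivalence S
  obtain ⟨A, hA, e, hAT⟩ := hT.exists_resolving_angle X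
  have h0 : A.m 0 (by lia) ≫ e.hom ≫ f = 0 :=
    eq_zero_of_map_eq_zero (hAT 0 (by lia)) (by
      rw [Functor.map_comp, Functor.map_comp, hf, comp_zero, comp_zero])
  obtain ⟨b, hb⟩ := R.exists_desc (𝒜.homExact_conn hd hA) _ h0
  exact ⟨_, add_map S (hAT d (by lia)), e.inv ≫ A.c, b, by simp [hb]⟩

/-- The restriction of `φ` to G(T_0) comes from a morphism `g` that kills T_1 ⟶ T_0. It descends to
X by the weak cokernel property, and the descent induces `φ` because G(T_0) ⟶ G(X) is epi. -/
theorem full_homFunctor (hT : 𝒜.IsClusterTilting T) (hd : 1 ≤ d) (R : SerreFunctor k C) :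
    (homFunctor T).Full where
  map_surjective {X Y} φ := by
    obtain ⟨A, hA, e, hAT⟩ := hT.exists_resolving_angle X
    obtain ⟨g, hg⟩ := exists_map_eq_of_add (hAT 0 (by lia))
      ((homFunctor T).map (A.m 0 (by lia) ≫ e.hom) ≫ φ)
    have h0 : A.m 1 (by lia) ≫ g = 0 := eq_zero_of_map_eq_zero (hAT 1 (by lia)) (by
      rw [Functor.map_comp]
      refine (congrArg (_ ≫ ·) hg).trans ?_
      rw [← Functor.map_comp_assoc, ← Category.assoc, (𝒜.homExact_m hA 0 (by lia)).zero,
        zero_comp, Functor.map_zero, zero_comp])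
    obtain ⟨b, hb⟩ := R.exists_desc (𝒜.homExact_m hA 0 (by lia)) g h0
    refine ⟨e.inv ≫ b, ?_⟩
    have := hT.epi_map_m_zero hd hA (hAT d (by lia))
    rw [← cancel_epi ((homFunctor T).map e.hom), ← cancel_epi ((homFunctor T).map (A.m 0 _)),
      ← Functor.map_comp, ← Functor.map_comp, ← Functor.map_comp_assoc, ← hg,
      e.hom_inv_id_assoc, hb]

theorem inducesEquivalence (hT : 𝒜.IsClusterTilting T) (hd : 1 ≤ d) (R : SerreFunctor k C) :
    InducesEquivalence (homFunctor T).toEssImage (add (S.obj T)) := by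
  have := hT.full_homFunctor hd R
  have H (X Y : C) (f g : X ⟶ Y) (h : idealRel (add (S.obj T)) f g) :
      (homFunctor T).toEssImage.map f = (homFunctor T).toEssImage.map g := by
    obtain ⟨Z, hZ, a, b, hab⟩ := h
    apply (homFunctor T).essImage.ι.map_injective
    change (homFunctor T).map f = (homFunctor T).map g
    rw [← sub_eq_zero, ← Functor.map_sub, hab, hT.map_eq_zero_of_add hZ]
  refine ⟨H, { faithful := ⟨?_⟩, full := ⟨?_⟩, essSurj := ⟨?_⟩ }⟩
  · intro X Y f g hfg
    obtain ⟨f, rfl⟩ := (Quotient.functor _).map_surjective (X := X.as) (Y := Y.as) f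
    obtain ⟨g, rfl⟩ := (Quotient.functor _).map_surjective (X := X.as) (Y := Y.as) g
    apply CategoryTheory.Quotient.sound
    have h1 : (homFunctor T).map f = (homFunctor T).map g :=
      congrArg (homFunctor T).essImage.ι.map hfg
    exact hT.exists_factor_of_map_eq_zero hd R (by rw [Functor.map_sub, h1, sub_self])
  · intro X Y f
    obtain ⟨g, hg⟩ := (homFunctor T).toEssImage.map_surjective (X := X.as) (Y := Y.as) f
    exact ⟨(Quotient.functor _).map g, hg⟩
  · intro M
    obtain ⟨X, ⟨e⟩⟩ := Functor.EssSurj.mem_essImage (F := (homFunctor T).toEssImage) M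
    exact ⟨(Quotient.functor _).obj X, ⟨e⟩⟩

end Functor

end IsClusterTilting

end Angulation

/-! ### Vanishing of Ext and bounds on dimensions. -/

section ClusterTilting

open Abelian (Ext)

variable {k : Type w} [Field k] {C : Type u} [Category.{v} C] [Preadditive C] [Linear k C]
  [HasFiniteBiproducts C]

/-- Hom(X, R T) is dual to Hom(T, X), so a morphism X ⟶ R T is determined by its composites with
morphisms T ⟶ X. -/
theorem SerreFunctor.eq_zero_of_map_eq_zero (R : SerreFunctor k C) {T X Y : C}
    (hY : add (R.functor.obj T) Y) {f : X ⟶ Y} (hf : (homFunctor T).map f = 0) : f = 0 := by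
  have key (g : X ⟶ R.functor.obj T) (hg : ∀ t : T ⟶ X, t ≫ g = 0) : g = 0 := by
    obtain ⟨φ, rfl⟩ := (R.iso T X).surjective g
    have : φ = 0 := by
      ext t
      have h1 := hg t
      rw [← R.naturality_right] at h1
      have h2 := (R.iso T T).injective (h1.trans (map_zero _).symm)
      simpa using LinearMap.congr_fun h2 (𝟙 T)
    rw [this, map_zero]
  have h0 (t : T ⟶ X) : t ≫ f = 0 := ConcreteCategory.congr_hom hf t
  obtain ⟨n, ⟨r⟩⟩ := hY
  have : f ≫ r.i = 0 := biproduct.hom_ext _ _ fun j => by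
    rw [zero_comp]
    exact key _ fun t => by rw [← Category.assoc, ← Category.assoc, h0, zero_comp, zero_comp]
  rw [← Category.comp_id f, ← r.retract, reassoc_of% this, zero_comp]

namespace Angulation

omit [Linear k C] in
-- If `t` is killed by the first morphism of the angle, then Σt lifts along the connecting morphism
-- to a map ΣT ⟶ A_0, which is zero.
theorem mono_map_m_last {d : ℕ} {S : C ⥤ C} [S.IsEquivalence] (𝒜 : Angulation C S d) {T : C}
    (hd : 1 ≤ d) {A : SigmaSeq C S d}
    (hA : A ∈ 𝒜.angles) (h : ∀ f : S.obj T ⟶ A.o 0 (by lia), f = 0) :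
    Mono ((homFunctor T).map (A.m d (by lia))) := by
  rw [ModuleCat.mono_iff_injective, injective_iff_map_eq_zero]
  intro t ht
  change T ⟶ A.o (d + 1) _ at t
  change t ≫ A.m d _ = 0 at ht
  obtain ⟨l, hl⟩ := (𝒜.homExact_map hd hA).exists_lift (S.map t) (by
    rw [← S.map_comp, ht, S.map_zero])
  rw [h l, zero_comp] at hl
  exact S.map_injective (hl.symm.trans (S.map_zero _ _).symm)

namespace IsClusterTilting

variable {d : ℕ} {S : C ⥤ C} [S.IsEquivalence] {𝒜 : Angulation C S d} {T : C}

theorem subsingleton_ext_homFunctor (hT : 𝒜.IsClusterTilting T) (R : SerreFunctor k C) (X Y : C)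
    (i : ℕ) (hi : 1 ≤ i) (hid : i < d) :
    Subsingleton (Ext.{v} ((homFunctor T).obj X) ((homFunctor T).obj Y) i) := by
  obtain ⟨A, hA, e, hAT⟩ := hT.exists_resolving_angle X
  -- The images are the syzygies of G(X). The bound keeps A_(j+3), A_(j+2) and A_(j+1) inside the
  -- angle when i = 0: a map from the syzygy to G(Y) lifts to A_(j+2) ⟶ Y, kills A_(j+3), and so
  -- extends to A_(j+1).
  have key (i : ℕ) : ∀ (j : ℕ) (hj : i + 1 + j < d), Subsingleton (Ext.{v}
      (image ((homFunctor T).map (A.m j (by lia)))) ((homFunctor T).obj Y) (i + 1)) := by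
    induction i with
    | zero =>
      intro j hj
      obtain ⟨w, hS⟩ := 𝒜.exists_shortExact (isWeaklyExact_homFunctor T) hA j (by lia)
      have := projective_homFunctor (hAT j (by lia))
      refine subsingleton_ext_one_of_extend hS fun φ => ?_
      obtain ⟨h, hh⟩ := exists_map_eq_of_add (hAT (j + 1) (by lia))
        (factorThruImage ((homFunctor T).map (A.m (j + 1) (by lia))) ≫ φ)
      have h0 : A.m (j + 2) (by lia) ≫ h = 0 := by
        refine eq_zero_of_map_eq_zero (hAT (j + 2) (by lia)) ?_
        rw [Functor.map_comp, hh, ← Category.assoc]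
        have : (homFunctor T).map (A.m (j + 2) (by lia)) ≫
            factorThruImage ((homFunctor T).map (A.m (j + 1) (by lia))) = 0 := by
          rw [← cancel_mono (image.ι _), Category.assoc, image.fac, ← Functor.map_comp,
            (𝒜.homExact_m hA (j + 1) (by lia)).zero, Functor.map_zero, zero_comp]
        rw [this, zero_comp]
      obtain ⟨b, hb⟩ := R.exists_desc (𝒜.homExact_m hA (j + 1) (by lia)) h h0
      refine ⟨(homFunctor T).map b, ?_⟩
      change image.ι _ ≫ _ = _
      rw [← cancel_epi (factorThruImage _), image.fac_assoc, ← hh, ← Functor.map_comp, hb]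
    | succ i ih =>
      intro j hj
      obtain ⟨w, hS⟩ := 𝒜.exists_shortExact (isWeaklyExact_homFunctor T) hA j (by lia)
      have := projective_homFunctor (hAT j (by lia))
      exact subsingleton_ext_succ hS (i + 1) (ih (j + 1) (by lia))
  obtain ⟨i, rfl⟩ : ∃ l, i = l + 1 := ⟨i - 1, by lia⟩
  have := hT.epi_map_m_zero (by lia) hA (hAT d (by lia))
  exact subsingleton_ext_of_iso ((homFunctor T).mapIso e.symm ≪≫
    isoImage ((homFunctor T).map (A.m 0 _)) (𝟙 _) (Category.comp_id _)) (Iso.refl _)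
    (key i 0 (by lia))

/-- The hypothesis makes G(T_d) ⟶ G(T_(d-1)) mono, so the resolving angle of `X` gives a projective
resolution ending at G(T_d). -/
theorem hasProjectiveDimensionLE (hT : 𝒜.IsClusterTilting T) (hd : 1 ≤ d) {X : C}
    (hX : ∀ f : S.obj T ⟶ X, f = 0) : HasProjectiveDimensionLE ((homFunctor T).obj X) d := by
  obtain ⟨A, hA, e, hAT⟩ := hT.exists_resolving_angle X
  have := 𝒜.mono_map_m_last hd hA (T := T) fun f => by
    rw [← cancel_mono e.hom, zero_comp]; exact hX _
  have := hT.epi_map_m_zero hd hA (hAT d (by lia))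
  have h1 := (𝒜.hasLeftResolution_image (isWeaklyExact_homFunctor T) hA _
    (fun i hi => projective_homFunctor (hAT i (by lia)))
    (Projective.of_iso (isoImage (𝟙 _) _ (Category.id_comp _))
      (projective_homFunctor (hAT d (by lia)))) d 0 (by lia)).hasProjectiveDimensionLE
  exact hasProjectiveDimensionLT_of_iso ((isoImage ((homFunctor T).map (A.m 0 _)) (𝟙 _)
    (Category.comp_id _)).symm ≪≫
    (homFunctor T).mapIso e) (d + 1)

/-- Let R Z ≅ X. The angle resolving ΣZ, desuspended at its left end, reads Z ⟶ T_d ⟶ ⋯ ⟶ T_0 ⟶ ΣZ.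
Hom(T, R -) turns it into an injective coresolution of G(X) of length d once both ends are exact. -/
theorem hasInjectiveDimensionLE (hT : 𝒜.IsClusterTilting T) (hd : 1 ≤ d) (R : SerreFunctor k C)
    {X : C} (hX : ∀ f : T ⟶ S.obj X, f = 0) :
    HasInjectiveDimensionLE ((homFunctor T).obj X) d := by
  let Z := R.functor.objPreimage X
  let eZ : R.functor.obj Z ≅ X := R.functor.objObjPreimageIso X
  obtain ⟨A, hA, e, hAT⟩ := hT.exists_resolving_angle (S.obj Z)
  have hG : IsWeaklyExact (R.functor ⋙ homFunctor T) :=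
    (isWeaklyExact_homFunctor T).comp R.functor
  have hinj (i : ℕ) (hi : i < d + 1) :
      Injective ((R.functor ⋙ homFunctor T).obj (A.o (i + 1) (by lia))) :=
    R.injective_homFunctor_of_add T (hAT i hi)
  have hzero {X Y : C} (f : X ⟶ Y) (h : ∀ g : X ⟶ T, g = 0) :
      (R.functor ⋙ homFunctor T).map f = 0 := by
    refine ModuleCat.hom_ext (LinearMap.ext fun t => ?_)
    change T ⟶ R.functor.obj X at t
    change t ≫ R.functor.map f = 0
    rw [(R.eq_zero_iff X T).1 h t, zero_comp]
  have hzero' {X Y : C} (f : Y ⟶ X) (h : ∀ g : X ⟶ T, g = 0) :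
      (R.functor ⋙ homFunctor T).map f = 0 := by
    refine ModuleCat.hom_ext (LinearMap.ext fun t => ?_)
    exact (R.eq_zero_iff X T).1 h _
  -- Right end: Hom(ΣZ, T) ≅ Hom(Z, Σ⁻¹T) vanishes because it is dual to Hom(Σ⁻¹T, RZ) ≅ Hom(T, ΣX).
  have h0 : (R.functor ⋙ homFunctor T).map (A.m 0 (by lia)) = 0 := by
    refine hzero' _ fun g => ?_
    obtain ⟨g', hg'⟩ := S.map_surjective (e.inv ≫ g ≫ (S.objObjPreimageIso T).inv)
    have h1 : g' = 0 := (R.eq_zero_iff _ _).2 (fun f => by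
      apply S.map_injective
      rw [← cancel_epi (S.objObjPreimageIso T).inv, ← cancel_mono (S.map eZ.hom), S.map_zero,
        comp_zero, zero_comp]
      exact hX _) g'
    rw [h1, S.map_zero] at hg'
    rw [← cancel_mono (S.objObjPreimageIso T).inv, ← cancel_epi e.inv, zero_comp, comp_zero, hg']
  have h1 : Injective (image ((R.functor ⋙ homFunctor T).map (A.m 1 (by lia)))) := by
    obtain ⟨w, h⟩ := hG (𝒜.homExact_m hA 0 (by lia))
    have : Epi ((R.functor ⋙ homFunctor T).map (A.m 1 (by lia))) := h.epi_f h0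
    exact Injective.of_iso (isoImage _ (𝟙 _) (Category.comp_id _)) (hinj 0 (by lia))
  have h2 := 𝒜.hasRightResolution_image hG hA _ 1 (fun i hi _ => hinj i (by lia)) (by lia) h1
    (d - 1) d (by lia) (by lia)
  obtain ⟨c, hc⟩ := S.map_surjective (e.inv ≫ A.c)
  have hcm : HomExact c (A.m d (by lia)) := by
    refine HomExact.of_map S ((𝒜.homExact_map hd hA).of_iso e (Iso.refl _) (Iso.refl _) ?_ ?_)
    · rw [hc]; simp
    · simp
  obtain ⟨b, hb⟩ := S.map_surjective
    ((S.objObjPreimageIso (A.o 1 (by lia))).hom ≫ A.m 0 (by lia) ≫ e.hom)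
  have hbc : HomExact b c := by
    refine HomExact.of_map S ((𝒜.homExact_conn hd hA).of_iso (S.objObjPreimageIso _).symm e
      (Iso.refl _) ?_ ?_)
    · rw [hb]; simp
    · rw [hc]; simp
  -- Left end: the source of `b` is Σ⁻¹T_0, and Hom(Σ⁻¹T_0, T) ≅ Hom(T_0, ΣT) = 0.
  have hb0 : (R.functor ⋙ homFunctor T).map b = 0 := hzero _ fun g => by
    apply S.map_injective
    rw [← cancel_epi (S.objObjPreimageIso _).inv, S.map_zero, comp_zero]
    exact hT.hom_shift_eq_zero (hAT 0 (by lia)) (add_self T) _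
  obtain ⟨w, hex⟩ := hG hbc
  have hmono : Mono ((R.functor ⋙ homFunctor T).map c) := hex.mono_g hb0
  obtain ⟨w', hex'⟩ := hG hcm
  obtain ⟨w'', hex''⟩ := exact_factorThruImage _ _ w' hex'
  have h3 : HasRightResolution (fun M => Injective M) (d - 1 + 1)
      ((R.functor ⋙ homFunctor T).obj Z) :=
    ⟨_, { exact := hex'' }, hinj d (by lia), rfl, h2⟩
  rw [Nat.sub_add_cancel hd] at h3
  have h4 : HasInjectiveDimensionLT ((homFunctor T).obj (R.functor.obj Z)) (d + 1) :=
    h3.hasInjectiveDimensionLE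
  exact hasInjectiveDimensionLT_of_iso ((homFunctor T).mapIso eZ) (d + 1)

end IsClusterTilting

end Angulation

end ClusterTilting

/-! ### Approximations and the main statements. -/

section MainResults

open Abelian (Ext)

variable {k : Type w} [Field k] {C : Type u} [Category.{v} C] [Preadditive C] [Linear k C]

theorem finiteDimensional_endOp {T : C} (hfin : ∀ X Y : C, FiniteDimensional k (X ⟶ Y)) :
    FiniteDimensional k (EndOp T) :=
  have := hfin T T
  Module.Finite.equiv (MulOpposite.opLinearEquiv k : (T ⟶ T) ≃ₗ[k] (T ⟶ T)ᵐᵒᵖ)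

theorem isNoetherianRing_endOp {T : C} (hfin : ∀ X Y : C, FiniteDimensional k (X ⟶ Y)) :
    IsNoetherianRing (EndOp T) :=
  have := finiteDimensional_endOp (T := T) hfin
  isNoetherian_of_tower k inferInstance

theorem finite_homFunctor {T : C} (hfin : ∀ X Y : C, FiniteDimensional k (X ⟶ Y)) (X : C) :
    Module.Finite (EndOp T) ((homFunctor T).obj X) := by
  have := hfin T X
  have : IsScalarTower k (EndOp T) (T ⟶ X) := ⟨fun c a t => by
    change (c • (show T ⟶ T from a.unop)) ≫ t = c • ((show T ⟶ T from a.unop) ≫ t)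
    rw [Linear.smul_comp]⟩
  exact Module.Finite.of_restrictScalars_finite k (EndOp T) (T ⟶ X)

theorem finDimModules_of_essImage {T : C} (hfin : ∀ X Y : C, FiniteDimensional k (X ⟶ Y))
    {M : ModuleCat.{v} (EndOp T)} (hM : (homFunctor T).essImage M) :
    finDimModules k (EndOp T) M := by
  obtain ⟨X, ⟨e⟩⟩ := hM
  have := finiteDimensional_endOp (T := T) hfin
  rw [finDimModules_iff_finite]
  have := finite_homFunctor (T := T) hfin X
  exact Module.Finite.equiv e.toLinearEquiv

variable [HasFiniteBiproducts C]

namespace Angulation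

namespace IsClusterTilting

variable {d : ℕ} {S : C ⥤ C} [S.IsEquivalence] {𝒜 : Angulation C S d} {T : C}

/-- A finite module is the kernel of the map induced by the last morphism of an angle between
objects of `add (R T)`. -/
theorem exists_angle_kernel (hT : 𝒜.IsClusterTilting T) (hd : 1 ≤ d) (R : SerreFunctor k C)
    (hfin : ∀ X Y : C, FiniteDimensional k (X ⟶ Y)) (M : ModuleCat.{v} (EndOp T))
    [Module.Finite (EndOp T) M] :
    ∃ A ∈ 𝒜.angles, add (R.functor.obj T) (A.o 0 (by lia)) ∧
      ∃ (i : M ⟶ (homFunctor T).obj (A.o 1 (by lia))) (_ : Mono i) (w : _),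
        (ShortComplex.mk i ((homFunctor T).map (A.m 0 (by lia))) w).Exact := by
  have := hT.full_homFunctor hd R
  obtain ⟨I₁, h₁, i, hi⟩ := R.exists_mono_homFunctor T (hfin T T) M
  have := finite_homFunctor (T := T) hfin I₁
  have : Module.Finite (EndOp T) (cokernel i : ModuleCat.{v} (EndOp T)) :=
    Module.Finite.of_surjective (cokernel.π i).hom
      ((ModuleCat.epi_iff_surjective _).1 inferInstance)
  obtain ⟨I₀, h₀, j, hj⟩ := R.exists_mono_homFunctor T (hfin T T) (cokernel i)
  obtain ⟨f, hf⟩ := (homFunctor T).map_surjective (cokernel.π i ≫ j)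
  obtain ⟨A, hA, e₁, e₀, he⟩ := 𝒜.exists_angle_m_zero f
  have w : i ≫ (homFunctor T).map f = 0 := by rw [hf, cokernel.condition_assoc, zero_comp]
  have hex : (ShortComplex.mk i ((homFunctor T).map f) w).Exact := by
    let α : ShortComplex.mk i (cokernel.π i) (cokernel.condition i) ⟶
        ShortComplex.mk i ((homFunctor T).map f) w :=
      { τ₁ := 𝟙 _, τ₂ := 𝟙 _, τ₃ := j, comm₂₃ := (Category.id_comp _).trans hf }
    have : Epi α.τ₁ := inferInstanceAs (Epi (𝟙 _))
    have : IsIso α.τ₂ := inferInstanceAs (IsIso (𝟙 _))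
    have : Mono α.τ₃ := hj
    exact (ShortComplex.exact_iff_of_epi_of_isIso_of_mono α).1 (ShortComplex.exact_cokernel i)
  have he' : (homFunctor T).map e₁.inv ≫ (homFunctor T).map (A.m 0 (by lia)) =
      (homFunctor T).map f ≫ (homFunctor T).map e₀.inv := by
    rw [← Functor.map_comp, ← Functor.map_comp, e₁.inv_comp_eq.2 ((e₀.eq_comp_inv).2 (by
      rw [he]) |>.trans (Category.assoc _ _ _))]
  refine ⟨A, hA, add_of_iso h₀ e₀.symm, i ≫ (homFunctor T).map e₁.inv, inferInstance, ?_, ?_⟩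
  · rw [Category.assoc, he', reassoc_of% w, zero_comp]
  · refine ShortComplex.exact_of_iso (ShortComplex.isoMk (S₁ := ShortComplex.mk _ _ w)
      (S₂ := ShortComplex.mk _ _ (by rw [Category.assoc, he', reassoc_of% w, zero_comp]))
      (Iso.refl _) ((homFunctor T).mapIso e₁.symm) ((homFunctor T).mapIso e₀.symm)
      (Category.id_comp _) he') hex

/-- A finite module is the cokernel of the map induced by the first morphism of an angle between
objects of `add T`. -/
theorem exists_angle_cokernel (hT : 𝒜.IsClusterTilting T) (hd : 1 ≤ d) (R : SerreFunctor k C)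
    (hfin : ∀ X Y : C, FiniteDimensional k (X ⟶ Y)) (M : ModuleCat.{v} (EndOp T))
    [Module.Finite (EndOp T) M] :
    ∃ A ∈ 𝒜.angles, add T (A.o (d + 1) (by lia)) ∧ add T (A.o d (by lia)) ∧
      ∃ (q : (homFunctor T).obj (A.o d (by lia)) ⟶ M) (_ : Epi q) (w : _),
        (ShortComplex.mk ((homFunctor T).map (A.m d (by lia))) q w).Exact := by
  have := hT.full_homFunctor hd R
  have := isNoetherianRing_endOp (T := T) hfin
  obtain ⟨T₀, h₀, q, hq⟩ := exists_epi_homFunctor M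
  have := finite_homFunctor (T := T) hfin T₀
  have : Module.Finite (EndOp T) (kernel q : ModuleCat.{v} (EndOp T)) :=
    Module.Finite.of_injective (kernel.ι q).hom
      ((ModuleCat.mono_iff_injective _).1 inferInstance)
  obtain ⟨T₁, h₁, p, hp⟩ := exists_epi_homFunctor (kernel q)
  obtain ⟨f, hf⟩ := (homFunctor T).map_surjective (p ≫ kernel.ι q)
  obtain ⟨A, hA, e₁, e₀, he⟩ := 𝒜.exists_angle_m_last f
  have w : (homFunctor T).map f ≫ q = 0 := by
    rw [hf, Category.assoc, kernel.condition, comp_zero]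
  have hex : (ShortComplex.mk ((homFunctor T).map f) q w).Exact := by
    let α : ShortComplex.mk ((homFunctor T).map f) q w ⟶
        ShortComplex.mk (kernel.ι q) q (kernel.condition q) :=
      { τ₁ := p, τ₂ := 𝟙 _, τ₃ := 𝟙 _, comm₁₂ := hf.symm.trans (Category.comp_id _).symm }
    have : Epi α.τ₁ := hp
    have : IsIso α.τ₂ := inferInstanceAs (IsIso (𝟙 _))
    have : Mono α.τ₃ := inferInstanceAs (Mono (𝟙 _))
    exact (ShortComplex.exact_iff_of_epi_of_isIso_of_mono α).2 (ShortComplex.exact_kernel q)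
  have he' : (homFunctor T).map (A.m d (by lia)) ≫ (homFunctor T).map e₀.hom =
      (homFunctor T).map e₁.hom ≫ (homFunctor T).map f := by
    rw [← Functor.map_comp, ← Functor.map_comp, he]
  refine ⟨A, hA, add_of_iso h₁ e₁.symm, add_of_iso h₀ e₀.symm, (homFunctor T).map e₀.hom ≫ q,
    inferInstance, ?_, ?_⟩
  · rw [← Category.assoc, he', Category.assoc, w, comp_zero]
  · refine ShortComplex.exact_of_iso (ShortComplex.isoMk (S₁ := ShortComplex.mk _ _ w)
      (S₂ := ShortComplex.mk _ _ (by rw [← Category.assoc, he', Category.assoc, w, comp_zero]))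
      ((homFunctor T).mapIso e₁.symm) ((homFunctor T).mapIso e₀.symm) (Iso.refl _) ?_ ?_) hex
    · change (homFunctor T).map e₁.inv ≫ (homFunctor T).map (A.m d _) =
        (homFunctor T).map f ≫ (homFunctor T).map e₀.inv
      rw [← Functor.map_comp, ← Functor.map_comp, e₁.inv_comp_eq.2 ((e₀.eq_comp_inv).2 (by
        rw [he]) |>.trans (Category.assoc _ _ _))]
    · change (homFunctor T).map e₀.inv ≫ (homFunctor T).map e₀.hom ≫ q = q ≫ 𝟙 _
      rw [← Functor.map_comp_assoc, e₀.inv_hom_id, CategoryTheory.Functor.map_id,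
        Category.id_comp, Category.comp_id]

/-- Each finite module has a right approximation by the essential image of `Hom(T, -)`, and a
resolution of length `d - 1`. -/
theorem exists_right_approximation (hT : 𝒜.IsClusterTilting T) (hd : 1 ≤ d) (R : SerreFunctor k C)
    (hfin : ∀ X Y : C, FiniteDimensional k (X ⟶ Y)) (M : ModuleCat.{v} (EndOp T))
    [Module.Finite (EndOp T) M] :
    (∃ (X : ModuleCat.{v} (EndOp T)) (_ : (homFunctor T).essImage X) (f : X ⟶ M),
      ∀ (X' : ModuleCat.{v} (EndOp T)) (_ : (homFunctor T).essImage X') (g : X' ⟶ M),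
        ∃ h : X' ⟶ X, h ≫ f = g) ∧
    HasLeftResolution (homFunctor T).essImage (d - 1) M := by
  have := hT.full_homFunctor hd R
  obtain ⟨A, hA, h₀, i, hi, w, hex⟩ := hT.exists_angle_kernel hd R hfin M
  obtain ⟨w', hex'⟩ := homFunctor_exact T (𝒜.homExact_m hA 0 (by lia))
  obtain ⟨q, hq, hqi⟩ := exists_epi_of_exact hex hex'
  constructor
  · refine ⟨_, (homFunctor T).obj_mem_essImage _, q, ?_⟩
    rintro X' ⟨Y, ⟨e⟩⟩ g
    obtain ⟨h, hh⟩ := (homFunctor T).map_surjective (e.hom ≫ g ≫ i)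
    -- Since A_0 is in `add (R T)`, G is faithful on morphisms into it; hence `h` lifts to A_2.
    have h0 : h ≫ A.m 0 (by lia) = 0 := R.eq_zero_of_map_eq_zero h₀ (by
      rw [Functor.map_comp, hh, Category.assoc, Category.assoc, w, comp_zero, comp_zero])
    obtain ⟨b, hb⟩ := (𝒜.homExact_m hA 0 (by lia)).exists_lift h h0
    refine ⟨e.inv ≫ (homFunctor T).map b, ?_⟩
    rw [← cancel_mono i, ← cancel_epi e.hom, Category.assoc, Category.assoc, hqi,
      e.hom_inv_id_assoc, ← Functor.map_comp, hb, hh]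
  -- Hom(ΣT, RT) is dual to Hom(T, ΣT) = 0, so the leftmost map is mono and the last syzygy is
  -- G(A_(d+1)).
  · have := 𝒜.mono_map_m_last hd hA (T := T)
      (eq_zero_of_add_right h₀ ((R.eq_zero_iff _ _).1 hT.hom_eq_zero))
    have h1 := 𝒜.hasLeftResolution_image (isWeaklyExact_homFunctor T) hA (homFunctor T).essImage
      (fun i hi => (homFunctor T).obj_mem_essImage _)
      ((homFunctor T).essImage.prop_of_iso
        (isoImage (𝟙 _) ((homFunctor T).map (A.m d _)) (Category.id_comp _))
        ((homFunctor T).obj_mem_essImage _)) (d - 1) 1 (by lia)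
    exact h1.of_iso (isoImage q i hqi).symm

/-- Each finite module has a left approximation by the essential image of `Hom(T, -)`, and a
coresolution of length `d - 1`. -/
theorem exists_left_approximation (hT : 𝒜.IsClusterTilting T) (hd : 1 ≤ d) (R : SerreFunctor k C)
    (hfin : ∀ X Y : C, FiniteDimensional k (X ⟶ Y)) (M : ModuleCat.{v} (EndOp T))
    [Module.Finite (EndOp T) M] :
    (∃ (X : ModuleCat.{v} (EndOp T)) (_ : (homFunctor T).essImage X) (f : M ⟶ X),
      ∀ (X' : ModuleCat.{v} (EndOp T)) (_ : (homFunctor T).essImage X') (g : M ⟶ X'),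
        ∃ h : X ⟶ X', f ≫ h = g) ∧
    HasRightResolution (homFunctor T).essImage (d - 1) M := by
  have := hT.full_homFunctor hd R
  obtain ⟨e, rfl⟩ : ∃ e, d = e + 1 := ⟨d - 1, by lia⟩
  obtain ⟨A, hA, h₁, h₀, q, hq, w, hex⟩ := hT.exists_angle_cokernel hd R hfin M
  obtain ⟨w', hex'⟩ := homFunctor_exact T (𝒜.homExact_m hA e (by lia))
  obtain ⟨i, hi, hqi⟩ := exists_mono_of_exact hex hex'
  constructor
  · refine ⟨_, (homFunctor T).obj_mem_essImage _, i, ?_⟩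
    rintro X' ⟨Y, ⟨φ⟩⟩ g
    obtain ⟨h, hh⟩ := (homFunctor T).map_surjective (q ≫ g ≫ φ.inv)
    have h0 : A.m (e + 1) (by lia) ≫ h = 0 := eq_zero_of_map_eq_zero h₁ (by
      rw [Functor.map_comp, hh, reassoc_of% w, zero_comp])
    obtain ⟨b, hb⟩ := R.exists_desc (𝒜.homExact_m hA e (by lia)) h h0
    refine ⟨(homFunctor T).map b ≫ φ.hom, ?_⟩
    rw [← cancel_mono φ.inv, ← cancel_epi q, Category.assoc, Category.assoc, φ.hom_inv_id,
      Category.comp_id, reassoc_of% hqi, ← Functor.map_comp, hb, hh]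
  -- As A_(d+1) is in `add T`, the rightmost map is epi and the coresolution ends in G(A_0).
  · have := hT.epi_map_m_zero hd hA h₁
    have h1 := 𝒜.hasRightResolution_image (isWeaklyExact_homFunctor T) hA (homFunctor T).essImage
      0 (fun i hi _ => (homFunctor T).obj_mem_essImage _) (by lia)
      ((homFunctor T).essImage.prop_of_iso
        (isoImage ((homFunctor T).map (A.m 0 _)) (𝟙 _) (Category.comp_id _))
        ((homFunctor T).obj_mem_essImage _)) e e (by lia) (by lia)
    exact h1.of_iso (isoImage q i hqi).symm

theorem subsingleton_ext_of_essImage (hT : 𝒜.IsClusterTilting T) (R : SerreFunctor k C)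
    {M N : ModuleCat.{v} (EndOp T)} (hM : (homFunctor T).essImage M)
    (hN : (homFunctor T).essImage N) (i : ℕ) (hi : 1 ≤ i) (hid : i < d) :
    Subsingleton (Ext.{v} M N i) := by
  obtain ⟨X, ⟨e⟩⟩ := hM
  obtain ⟨Y, ⟨e'⟩⟩ := hN
  exact subsingleton_ext_of_iso e.symm e'.symm (hT.subsingleton_ext_homFunctor R X Y i hi hid)

theorem isClusterTiltingSubcategory [IsIdempotentComplete C] (hT : 𝒜.IsClusterTilting T)
    (hd : 1 ≤ d) (R : SerreFunctor k C) (hfin : ∀ X Y : C, FiniteDimensional k (X ⟶ Y)) :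
    IsClusterTiltingSubcategory k d (homFunctor T).essImage := by
  have := hT.full_homFunctor hd R
  have := finiteDimensional_endOp (T := T) hfin
  refine ⟨⟨fun M => ⟨fun hM => ⟨finDimModules_of_essImage hfin hM, fun X hX i hi hid =>
    hT.subsingleton_ext_of_essImage R hM hX i hi hid⟩, fun ⟨hM, h⟩ => ?_⟩,
    fun M => ⟨fun hM => ⟨finDimModules_of_essImage hfin hM, fun X hX i hi hid =>
    hT.subsingleton_ext_of_essImage R hX hM i hi hid⟩, fun ⟨hM, h⟩ => ?_⟩⟩,
    ⟨fun M hM => ?_, fun M hM => ?_⟩⟩ <;>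
  have := (finDimModules_iff_finite k M).1 hM
  · obtain ⟨X, hX, ⟨r⟩⟩ := (hT.exists_right_approximation hd R hfin M).2.exists_retract
      fun X hX i hi hid => h X hX i hi (by lia)
    exact essImage_of_retract _ hfin r hX
  · obtain ⟨X, hX, ⟨r⟩⟩ := (hT.exists_left_approximation hd R hfin M).2.exists_retract
      fun X hX i hi hid => h X hX i hi (by lia)
    exact essImage_of_retract _ hfin r hX
  · exact (hT.exists_left_approximation hd R hfin M).1
  · exact (hT.exists_right_approximation hd R hfin M).1

/-- A finite projective module is a retract of G(X) with X in `add T`, and Hom(T, ΣX) = 0. -/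
theorem hasInjectiveDimensionLE_of_projective (hT : 𝒜.IsClusterTilting T) (hd : 1 ≤ d)
    (R : SerreFunctor k C) (M : ModuleCat.{v} (EndOp T)) (hM : Module.Finite (EndOp T) M)
    (hM' : Projective M) : HasInjectiveDimensionLE M d := by
  obtain ⟨X, hX, f, hf⟩ := exists_epi_homFunctor M
  have := hT.hasInjectiveDimensionLE hd R (hT.hom_shift_eq_zero (add_self T) hX)
  exact Retract.hasInjectiveDimensionLT
    ⟨Projective.factorThru (𝟙 M) f, f, Projective.factorThru_comp _ _⟩ (d + 1)

theorem isGorenstein (hT : 𝒜.IsClusterTilting T) (hd : 1 ≤ d) (R : SerreFunctor k C)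
    (hfin : ∀ X Y : C, FiniteDimensional k (X ⟶ Y)) : IsGorenstein k (EndOp T) d := by
  have := finiteDimensional_endOp (T := T) hfin
  refine ⟨fun M hM hM' => ?_, fun M hM hM' => ?_⟩ <;>
  have := (finDimModules_iff_finite k M).1 hM
  · obtain ⟨X, hX, f, hf⟩ := R.exists_mono_homFunctor T (hfin T T) M
    have := hT.hasProjectiveDimensionLE hd
      (eq_zero_of_add_right hX ((R.eq_zero_iff _ _).1 hT.hom_eq_zero))
    exact Retract.hasProjectiveDimensionLT
      ⟨f, Injective.factorThru (𝟙 M) f, Injective.comp_factorThru _ _⟩ (d + 1)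
  · exact hT.hasInjectiveDimensionLE_of_projective hd R M this hM'

end IsClusterTilting

end Angulation

end MainResults

end HigherAngulated

end

open HigherAngulated in
theorem theorem0p5 {k : Type w} [Field k] [IsAlgClosed k] (d : ℕ) (hd : 1 ≤ d)
    {𝒯 : Type u} [Category.{v} 𝒯] [Preadditive 𝒯] [Linear k 𝒯] [HasFiniteBiproducts 𝒯]
    [IsIdempotentComplete 𝒯] (hfin : ∀ X Y : 𝒯, FiniteDimensional k (X ⟶ Y))
    (S : 𝒯 ⥤ 𝒯) [S.IsEquivalence] (𝒜 : Angulation 𝒯 S d)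
    (hSerre : Nonempty (SerreFunctor k 𝒯)) (T : 𝒯) (hT : 𝒜.IsClusterTilting T) :
    IsClusterTiltingSubcategory k d (homFunctor T).essImage ∧
    InducesEquivalence (homFunctor T).toEssImage (add (S.obj T)) ∧
    IsGorenstein k (EndOp T) d ∧
    (globalDimension (EndOp T) < ⊤ → globalDimension (EndOp T) ≤ d) := by
  obtain ⟨R⟩ := hSerre
  have := isNoetherianRing_endOp (T := T) hfin
  exact ⟨hT.isClusterTiltingSubcategory hd R hfin, hT.inducesEquivalence hd R,
    hT.isGorenstein hd R hfin,
    globalDimension_le d (hT.hasInjectiveDimensionLE_of_projective hd R)⟩
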